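/- In the \emph{Byzantine secretary problem on a knapsack of capacity $K$}, an adversary fixes $n$ elements, each element $e$ with a size $s(e)\in[0,1]$ and a value $v(e)\ge 0$, a partition of the elements into green elements $G$ and red elements $R$, and an arrival time in $[0,1]$ for each red element. Then each green element independently receives a uniformly random arrival time in $[0,1]$. The elements are presented in the order of arrival (simultaneous red elements in an order chosen by the adversary). On the arrival of an element, a randomized online algorithm, which knows $n$, $K$ and $\varepsilon$, sees its arrival time, size and value, but not its colour, and must irrevocably select or discard it before seeing the next element; the total size of the selected elements must never exceed $K$. Let $g_{\max}$ be a green element of maximum value and let $$V^* := \max\Big\{\sum_{e\in S} v(e) \;:\; S\subseteq G\setminus\{g_{\max}\},\ \sum_{e\in S}s(e)\le K\Big\}$$ be the leave-one-out benchmark. Theorem (Knapsack). There are absolute constants $C>0$ and $a\in\mathbb{N}$ such that for all $\varepsilon\in(0,1)$, all $n$ and all $K\ge C\,(\varepsilon^{-1}\log n)^a$ there is a randomized online algorithm for the Byzantine secretary problem on a knapsack of capacity $K$ with $n$ elements that is $(1+\varepsilon)$-competitive with the benchmark $V^*$: on every instance with at least one green element, the expected total value of the elements it selects is at least $V^*/(1+\varepsilon)$,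 and hence at least $(1-\varepsilon)V^*$. -/

import Mathlib

namespace ByzantineKnapsack

open MeasureTheory

/-- An instance of the Byzantine secretary problem on a knapsack with `n` elements. The adversary
fixes the sizes in `[0,1]`, the nonnegative values, the set of green elements (the other elements
are red), and the arrival times in `[0,1]` of the red elements (`redTime e` is used only when
`e` is red). -/
structure Instance (n : ℕ) where
  size : Fin n → ℝ
  value : Fin n → ℝ
  green : Finset (Fin n)
  redTime : Fin n → unitInterval
  size_nonneg : ∀ e, 0 ≤ size e
  size_le_one : ∀ e, size e ≤ 1
  value_nonneg : ∀ e, 0 ≤ value e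

/-- What an online algorithm sees when an element arrives: its arrival time, size and value.
Neither the colour nor the name of the element is revealed. -/
abbrev Arrival : Type := unitInterval × ℝ × ℝ

/-- A randomized online algorithm. It draws a seed once, from a probability space of its own. When
an element arrives, it decides irrevocably whether to select it, knowing only the seed and the
elements that have arrived so far: `accept k ω h` is the decision on the last entry `h k` of the
sequence `h 0, …, h k` of the first `k + 1` arrivals. -/
structure OnlineAlgorithm where
  Seed : Type
  [measurableSpaceSeed : MeasurableSpace Seed]
  law : Measure Seed
  [isProbabilityMeasure_law : IsProbabilityMeasure law]
  accept : (k : ℕ) → Seed → (Fin (k + 1) → Arrival) → Bool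
  measurable_accept : ∀ k : ℕ,
    Measurable (fun p : Seed × (Fin (k + 1) → Arrival) => accept k p.1 p.2)

attribute [instance] OnlineAlgorithm.measurableSpaceSeed OnlineAlgorithm.isProbabilityMeasure_law

variable {n : ℕ}

namespace Instance

/-- The arrival times, when `u e` is the random time drawn for the green element `e`. -/
def arrivalTime (I : Instance n) (u : Fin n → unitInterval) (e : Fin n) : unitInterval :=
  if e ∈ I.green then u e else I.redTime e

/-- `I.order u i` is the element that arrives in position `i`: the elements are sorted by arrival
time, and elements that arrive at the same time are presented in the order of their indices
(so the adversary, who chooses the indices, chooses the order of simultaneous red elements). -/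
noncomputable def order (I : Instance n) (u : Fin n → unitInterval) : Equiv.Perm (Fin n) :=
  Tuple.sort (I.arrivalTime u)

/-- The data that the algorithm sees of the element in position `i` of the arrival sequence. -/
noncomputable def arrival (I : Instance n) (u : Fin n → unitInterval) (i : Fin n) : Arrival :=
  (I.arrivalTime u (I.order u i), I.size (I.order u i), I.value (I.order u i))

/-- `g` is a green element of maximum value. -/
def IsGreenMax (I : Instance n) (g : Fin n) : Prop :=
  g ∈ I.green ∧ ∀ e ∈ I.green, I.value e ≤ I.value g

/-- The leave-one-out benchmark for capacity `K`, when `g` is the green element that is left out: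
the largest total value of a set of green elements other than `g` of total size at most `K`. -/
noncomputable def benchmark (I : Instance n) (K : ℝ) (g : Fin n) : ℝ :=
  sSup {x : ℝ | ∃ S : Finset (Fin n), S ⊆ I.green.erase g ∧ ∑ e ∈ S, I.size e ≤ K ∧
    x = ∑ e ∈ S, I.value e}

end Instance

namespace OnlineAlgorithm

/-- The set of elements selected by the algorithm with seed `ω` when `u` gives the green times. -/
noncomputable def selected (A : OnlineAlgorithm) (I : Instance n) (ω : A.Seed)
    (u : Fin n → unitInterval) : Finset (Fin n) :=
  (Finset.univ.filter (fun i : Fin n =>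
    A.accept i ω (fun j : Fin (i + 1) =>
      I.arrival u (Fin.castLE (Nat.succ_le_of_lt i.isLt) j)) = true)).map (I.order u).toEmbedding

/-- The selected elements always fit into a knapsack of capacity `K`: for every instance with `n`
elements and every outcome of the seed and of the arrival times. -/
def IsFeasible (A : OnlineAlgorithm) (n : ℕ) (K : ℝ) : Prop :=
  ∀ (I : Instance n) (ω : A.Seed) (u : Fin n → unitInterval),
    ∑ e ∈ A.selected I ω u, I.size e ≤ K

/-- The expected total value of the selected elements, over the seed and the independent uniform
arrival times in `[0,1]` of the green elements. -/
noncomputable def expectedValue (A : OnlineAlgorithm) (I : Instance n) : ℝ :=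
  ∫ p : A.Seed × (Fin n → unitInterval), ∑ e ∈ A.selected I p.1 p.2, I.value e
    ∂(A.law.prod volume)

end OnlineAlgorithm

end ByzantineKnapsack

/-! Cut `[0,1]` into `T` slots and group the elements by density, rounded down to a power of `1 +
δ`. Within a level, size is as good as value up to a factor `1 + δ`, so red elements of a level may
well replace green ones. The harm red elements can do is to mislead about how much capacity each
level deserves.

The prediction for a level is its smallest load in an earlier slot, and the budget of a slot is
shared out by these predictions, densest level first. If the green elements of a level are spread
evenly over the slots, its prediction never falls far below their mean load, whatever red elements
are added, so the greedy shares are worth almost as much as the green ones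
(`sum_mul_le_sum_mul_greedy`, `le_gain_of_no_drop`). Shares are wasted only if a load falls below `1
- δ` times the running minimum. Starting from `n`, this happens `O(log n / δ)` times per level
(`card_drops_le`), hence in a small fraction of the slots, and each such slot costs at most twice
the mean green weight of a slot.

Levels with little green load need not be spread evenly. A reserve for every level and slot absorbs
them, and a variance bound controls the rest (`integral_unsteadyLoss_le`).

Only `O(log n / δ)` levels matter, and the total value seen in earlier slots locates them, provided
that the value of all elements is at most polynomially larger than the benchmark. If it is not, a
single element in a random position suffices; this is tried with probability `δ`. Elements of size
at most `1 / n` are always taken by the main rule.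

The window may be misplaced up to and including the first slot with a relevant green element. This
costs a `1 / T` fraction of the weight and one maximal weight (`le_integral_active`). The
leave-one-out benchmark pays for the latter: the element left out joins the comparison set, its
weight cut to that of the most valuable other member (`benchmark_le_integral`). -/

namespace ByzantineKnapsack

open MeasureTheory ProbabilityTheory

/-! ### Filling a capacity in the order of arrival -/

section PrefixSums

variable {α : Type*}

/-- The elements of `A` at which the total size of the prefix of `A` is still at most `c`. -/
noncomputable def fitting (A : Finset α) (pos : α → ℕ) (s : α → ℝ) (c : ℝ) : Finset α :=
  A.filter fun e => ∑ e' ∈ A.filter (fun e' => pos e' ≤ pos e), s e' ≤ c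

theorem sum_fitting_le (A : Finset α) (pos : α → ℕ) (s : α → ℝ) {c : ℝ} (hc : 0 ≤ c)
    (hs : ∀ e, 0 ≤ s e) : ∑ e ∈ fitting A pos s c, s e ≤ c := by
  rcases (fitting A pos s c).eq_empty_or_nonempty with h | h
  · simpa [h] using hc
  · obtain ⟨m, hm, hmax⟩ := Finset.exists_max_image _ pos h
    refine le_trans ?_ (Finset.mem_filter.1 hm).2
    refine Finset.sum_le_sum_of_subset_of_nonneg ?_ fun e _ _ => hs e
    intro e he
    exact Finset.mem_filter.2 ⟨(Finset.mem_filter.1 he).1, hmax e he⟩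

/-- If `m` is the earliest element that does not fit, its prefix exceeds `c` and all other elements
of that prefix fit. So the fitting elements exceed `c - s m ≥ c - 1`. -/
theorem le_sum_fitting [DecidableEq α] (A : Finset α) {pos : α → ℕ} (hpos : Function.Injective pos) (s : α → ℝ)
    (c : ℝ) (hs : ∀ e, 0 ≤ s e) (hs1 : ∀ e, s e ≤ 1) :
    min (∑ e ∈ A, s e) (c - 1) ≤ ∑ e ∈ fitting A pos s c, s e := by
  rcases (A \ fitting A pos s c).eq_empty_or_nonempty with h | h
  · refine (min_le_left _ _).trans (Finset.sum_le_sum_of_subset_of_nonneg ?_ fun e _ _ => hs e)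
    exact Finset.sdiff_eq_empty_iff_subset.1 h
  · obtain ⟨m, hm, hmin⟩ := Finset.exists_min_image _ pos h
    have hmA := (Finset.mem_sdiff.1 hm).1
    have hgt : c < ∑ e' ∈ A.filter (fun e' => pos e' ≤ pos m), s e' := by
      by_contra hle
      exact (Finset.mem_sdiff.1 hm).2 (Finset.mem_filter.2 ⟨hmA, not_lt.1 hle⟩)
    refine (min_le_right _ _).trans ?_
    have hsub : (A.filter fun e' => pos e' ≤ pos m) ⊆ insert m (fitting A pos s c) := by
      intro e he
      obtain ⟨heA, hle⟩ := Finset.mem_filter.1 he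
      by_cases hem : e = m
      · simp [hem]
      · refine Finset.mem_insert_of_mem ?_
        by_contra hf
        have := hmin e (Finset.mem_sdiff.2 ⟨heA, hf⟩)
        exact hem (hpos (le_antisymm hle this))
    have hm' : m ∉ fitting A pos s c := (Finset.mem_sdiff.1 hm).2
    have h1 := Finset.sum_le_sum_of_subset_of_nonneg hsub fun e _ _ => hs e
    rw [Finset.sum_insert hm'] at h1
    linarith [hs1 m]

end PrefixSums

/-! ### Greedy allocation of a budget to levels -/

section Greedy

/-- The greedy allocation: the level `ℓ` receives at most `e ℓ`, and at most what the higher levels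
up to `top` leave of the budget `B`. -/
noncomputable def greedy (B : ℝ) (e : ℤ → ℝ) (top ℓ : ℤ) : ℝ :=
  min (e ℓ) (max (B - ∑ k ∈ Finset.Ioc ℓ top, e k) 0)

variable {B : ℝ} {e : ℤ → ℝ} {top : ℤ}

theorem greedy_le (ℓ : ℤ) : greedy B e top ℓ ≤ e ℓ := min_le_left _ _

theorem greedy_nonneg (he : ∀ k, 0 ≤ e k) (ℓ : ℤ) : 0 ≤ greedy B e top ℓ :=
  le_min (he ℓ) (le_max_right _ _)

theorem Icc_eq_cons (ℓ top : ℤ) (h : ℓ ≤ top) :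
    Finset.Icc ℓ top = insert ℓ (Finset.Icc (ℓ + 1) top) := by
  ext k; simp only [Finset.mem_Icc, Finset.mem_insert]; omega

theorem sum_Icc_step (F : ℤ → ℝ) (ℓ top : ℤ) (h : ℓ ≤ top) :
    ∑ k ∈ Finset.Icc ℓ top, F k = F ℓ + ∑ k ∈ Finset.Icc (ℓ + 1) top, F k := by
  rw [Icc_eq_cons ℓ top h, Finset.sum_insert (by simp)]

/-- Each level takes its full demand until the budget runs out. The left end `top + 1 - m` makes `m`
the number of levels, so that the induction starts from the empty interval. -/
theorem sum_greedy (hB : 0 ≤ B) (he : ∀ k, 0 ≤ e k) (m : ℕ) :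
    ∑ k ∈ Finset.Icc (top + 1 - m) top, greedy B e top k
      = min B (∑ k ∈ Finset.Icc (top + 1 - m) top, e k) := by
  induction m with
  | zero => simp [hB]
  | succ m ih =>
    have h1 : top + 1 - ((m + 1 : ℕ) : ℤ) + 1 = top + 1 - m := by push_cast; ring
    have h2 : top + 1 - ((m + 1 : ℕ) : ℤ) ≤ top := by push_cast; omega
    rw [sum_Icc_step _ _ _ h2, sum_Icc_step _ _ _ h2, h1, ih, greedy]
    have h3 : Finset.Ioc (top + 1 - ((m + 1 : ℕ) : ℤ)) top = Finset.Icc (top + 1 - m) top := by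
      ext k; simp only [Finset.mem_Icc, Finset.mem_Ioc]; push_cast; omega
    rw [h3]
    have := he (top + 1 - ((m + 1 : ℕ) : ℤ))
    set S := ∑ k ∈ Finset.Icc (top + 1 - (m : ℤ)) top, e k
    set x := e (top + 1 - ((m + 1 : ℕ) : ℤ))
    rcases le_total B S with h | h
    · rw [max_eq_right (by linarith), min_eq_left h, min_eq_right this, min_eq_left (by linarith)]
      ring
    · rw [max_eq_left (by linarith), min_eq_right h]
      rcases le_total x (B - S) with h' | h'
      · rw [min_eq_left h', min_eq_right (by linarith)]
      · rw [min_eq_right h', min_eq_left (by linarith)]; ring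

theorem sum_greedy_le (hB : 0 ≤ B) (he : ∀ k, 0 ≤ e k) (m : ℕ) :
    ∑ k ∈ Finset.Icc (top + 1 - m) top, greedy B e top k ≤ B :=
  (sum_greedy hB he m).trans_le (min_le_left _ _)

/-- Greedy filling maximises every increasing linear functional over the feasible allocations. -/
theorem sum_mul_le_sum_mul_greedy (hB : 0 ≤ B) (he : ∀ k, 0 ≤ e k) {τ : ℤ → ℝ}
    (hτ : Monotone τ) (hτ0 : ∀ k, 0 ≤ τ k) {b : ℤ → ℝ} (hb0 : ∀ k, 0 ≤ b k) (hb : ∀ k, b k ≤ e k)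
    (m : ℕ) (hsum : ∑ k ∈ Finset.Icc (top + 1 - m) top, b k ≤ B) :
    ∑ k ∈ Finset.Icc (top + 1 - m) top, τ k * b k
      ≤ ∑ k ∈ Finset.Icc (top + 1 - m) top, τ k * greedy B e top k := by
  -- summation by parts against the tail sums
  have key : ∀ j : ℕ, j ≤ m → ∑ k ∈ Finset.Icc (top + 1 - j) top, τ k * b k
      + τ (top - j) * (∑ k ∈ Finset.Icc (top + 1 - j) top, greedy B e top k
        - ∑ k ∈ Finset.Icc (top + 1 - j) top, b k)
      ≤ ∑ k ∈ Finset.Icc (top + 1 - j) top, τ k * greedy B e top k := by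
    intro j
    induction j with
    | zero => simp
    | succ j ih =>
      intro hj
      have ih' := ih (by omega)
      have h1 : top + 1 - ((j + 1 : ℕ) : ℤ) + 1 = top + 1 - j := by push_cast; ring
      have h2 : top + 1 - ((j + 1 : ℕ) : ℤ) ≤ top := by push_cast; omega
      have h4 : top + 1 - ((j + 1 : ℕ) : ℤ) = top - j := by push_cast; ring
      have htail : ∑ k ∈ Finset.Icc (top - j) top, b k
          ≤ ∑ k ∈ Finset.Icc (top - j) top, greedy B e top k := by
        rw [← h4, sum_greedy hB he]
        refine le_min (le_trans ?_ hsum) (Finset.sum_le_sum fun k _ => hb k)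
        refine Finset.sum_le_sum_of_subset_of_nonneg ?_ fun k _ _ => hb0 k
        intro k; simp only [Finset.mem_Icc]; omega
      rw [h4] at h1 h2 ⊢
      have hmono : τ (top - ((j + 1 : ℕ) : ℤ)) ≤ τ (top - j) := hτ (by push_cast; omega)
      have hp := mul_le_mul_of_nonneg_right hmono (sub_nonneg.2 htail)
      rw [sum_Icc_step b _ _ h2, sum_Icc_step (greedy B e top) _ _ h2, h1] at hp ⊢
      rw [sum_Icc_step (fun k => τ k * b k) _ _ h2,
        sum_Icc_step (fun k => τ k * greedy B e top k) _ _ h2, h1]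
      nlinarith [hp, ih']
  have h := key m le_rfl
  have htail : ∑ k ∈ Finset.Icc (top + 1 - m) top, b k
      ≤ ∑ k ∈ Finset.Icc (top + 1 - m) top, greedy B e top k := by
    rw [sum_greedy hB he]
    exact le_min hsum (Finset.sum_le_sum fun k _ => hb k)
  nlinarith [mul_nonneg (hτ0 (top - m)) (sub_nonneg.2 htail)]

end Greedy

/-- The parameters of the algorithm: the number `T` of time slots, the half-width `radius` of the
window of density levels, the accuracy `δ` of the levels, the capacity `reserve` set aside for every
level of the window in every slot, and the capacity `budget` of a slot that is filled greedily. -/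
structure Params (n : ℕ) where
  T : ℕ
  radius : ℕ
  δ : ℝ
  reserve : ℝ
  budget : ℝ

/-! ### The acceptance rule -/

namespace Params

variable {n : ℕ} (P : Params n) {ι : Type*} [Fintype ι]

/-- The time slot of an arrival time. -/
noncomputable def slot (t : unitInterval) : ℕ := ⌈(t : ℝ) * P.T⌉₊ - 1

/-- The density level of an item. -/
noncomputable def level (a : Arrival) : ℤ := ⌊Real.logb (1 + P.δ) (a.2.2 / a.2.1)⌋

/-- Items that are neither tiny nor worthless. -/
def Eligible (n : ℕ) (a : Arrival) : Prop := 1 < n * a.2.1 ∧ 0 < a.2.2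

/-- The items that compete for the capacity of level `ℓ` in slot `i`. -/
def InClass (ℓ : ℤ) (i : ℕ) (a : Arrival) : Prop :=
  Eligible n a ∧ P.level a = ℓ ∧ P.slot a.1 = i

open Classical in
/-- The total size of the items of level `ℓ` in slot `i`. -/
noncomputable def load (h : ι → Arrival) (ℓ : ℤ) (i : ℕ) : ℝ :=
  ∑ j, if P.InClass ℓ i (h j) then (h j).2.1 else 0

/-- The total value of the items that arrive before slot `i`. -/
noncomputable def worth (h : ι → Arrival) (i : ℕ) : ℝ :=
  ∑ j, if P.slot (h j).1 < i then (h j).2.2 else 0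

/-- The centre of the window of levels in slot `i`. -/
noncomputable def center (h : ι → Arrival) (i : ℕ) : ℤ := ⌊Real.logb (1 + P.δ) (P.worth h i)⌋

/-- The smallest load of level `ℓ` in a slot before slot `i`. -/
noncomputable def low (h : ι → Arrival) (ℓ : ℤ) : ℕ → ℝ
  -- No load exceeds `n`, so this start value never constrains a level.
  | 0 => n
  | i + 1 => min (low h ℓ i) (P.load h ℓ i)

/-- The greedy demand of level `ℓ` in slot `i`. -/
noncomputable def excess (h : ι → Arrival) (i : ℕ) (ℓ : ℤ) : ℝ := max (P.low h ℓ i - P.reserve) 0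

/-- The greedy allocation in slot `i` when the window is centred at `c`. -/
noncomputable def alloc (h : ι → Arrival) (i : ℕ) (c ℓ : ℤ) : ℝ :=
  greedy P.budget (P.excess h i) (c + P.radius) ℓ

/-- The window of levels in slot `i`. -/
noncomputable def window (h : ι → Arrival) (i : ℕ) : Finset ℤ :=
  Finset.Icc (P.center h i - P.radius) (P.center h i + P.radius)

/-- The acceptance rule for an item `a` that arrives when the history, including `a`, is `h`. -/
def Accepts (h : ι → Arrival) (a : Arrival) : Prop :=
  n * a.2.1 ≤ 1 ∨ (Eligible n a ∧ P.level a ∈ P.window h (P.slot a.1) ∧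
    P.load h (P.level a) (P.slot a.1)
      ≤ P.alloc h (P.slot a.1) (P.center h (P.slot a.1)) (P.level a) + P.reserve + 1)

end Params

/-! ### From histories to the full outcome -/

namespace Instance

variable {n : ℕ} (I : Instance n) (u : Fin n → unitInterval)

/-- The data of the element `e`. -/
noncomputable def profile (e : Fin n) : Arrival := (I.arrivalTime u e, I.size e, I.value e)

/-- The position of the element `e` in the arrival order. -/
noncomputable def pos (e : Fin n) : ℕ := (I.order u).symm e

theorem pos_injective : Function.Injective (I.pos u) := fun _ _ h =>
  (I.order u).symm.injective (Fin.ext h)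

/-- The history at the arrival of the element in position `k`. -/
noncomputable def history (k : Fin n) (j : Fin (k + 1)) : Arrival :=
  I.arrival u (Fin.castLE (Nat.succ_le_of_lt k.isLt) j)

theorem sum_history (k : Fin n) (F : Arrival → ℝ) :
    ∑ j, F (I.history u k j) = ∑ e with I.pos u e ≤ k, F (I.profile u e) := by
  refine Finset.sum_bij (fun j _ => I.order u (Fin.castLE (Nat.succ_le_of_lt k.isLt) j)) ?_ ?_ ?_ ?_
  · intro j _
    refine Finset.mem_filter.2 ⟨Finset.mem_univ _, ?_⟩
    rw [pos, Equiv.symm_apply_apply, Fin.val_castLE]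
    have := j.isLt
    omega
  · intro a _ b _ hab
    simpa using hab
  · intro e he
    have he' : ((I.order u).symm e : ℕ) ≤ k := (Finset.mem_filter.1 he).2
    refine ⟨⟨(I.order u).symm e, by omega⟩, Finset.mem_univ _, ?_⟩
    rw [← Equiv.eq_symm_apply]
    rfl
  · intro j _
    rfl

theorem arrivalTime_le_of_pos_le {e e' : Fin n} (h : I.pos u e ≤ I.pos u e') :
    I.arrivalTime u e ≤ I.arrivalTime u e' := by
  have := Tuple.monotone_sort (I.arrivalTime u) (a := (I.order u).symm e)
    (b := (I.order u).symm e') h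
  simpa [order] using this

theorem history_last (e : Fin n) :
    I.history u ((I.order u).symm e) (Fin.last _) = I.profile u e := by
  have : (Fin.castLE (Nat.succ_le_of_lt ((I.order u).symm e).isLt) (Fin.last _))
      = (I.order u).symm e := by ext; simp
  simp [history, arrival, profile, this]

end Instance

namespace Params

variable {n : ℕ} (P : Params n) (I : Instance n) (u : Fin n → unitInterval)

theorem slot_mono {t t' : unitInterval} (h : t ≤ t') : P.slot t ≤ P.slot t' := by
  have : (t : ℝ) ≤ t' := h
  exact Nat.sub_le_sub_right (Nat.ceil_mono (by gcongr)) 1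

theorem slot_lt (hT : 0 < P.T) (t : unitInterval) : P.slot t < P.T := by
  have h : ⌈(t : ℝ) * P.T⌉₊ ≤ P.T := Nat.ceil_le.2 (by
    have := t.2.2; nlinarith [(Nat.cast_nonneg P.T : (0 : ℝ) ≤ P.T)])
  have : P.slot t ≤ P.T - 1 := Nat.sub_le_sub_right h 1
  omega

/-- The time slot in which the element `e` arrives. -/
noncomputable def slotOf (e : Fin n) : ℕ := P.slot (I.arrivalTime u e)

theorem pos_lt_of_slot_lt {e e' : Fin n} (h : P.slotOf I u e < P.slotOf I u e') :
    I.pos u e < I.pos u e' := by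
  by_contra hle
  exact absurd (P.slot_mono (I.arrivalTime_le_of_pos_le u (not_lt.1 hle))) (not_le.2 h)

variable (e : Fin n)

/-- All elements of earlier slots precede `e`, so what the rule derives from those slots is final
when `e` arrives. It can be replaced by quantities of the full outcome, the same for all elements of
a slot. -/
theorem load_history_of_lt (ℓ : ℤ) {i : ℕ} (hi : i < P.slotOf I u e) :
    P.load (I.history u ((I.order u).symm e)) ℓ i = P.load (I.profile u) ℓ i := by
  classical
  unfold load
  rw [I.sum_history u _ (fun a => if P.InClass ℓ i a then a.2.1 else 0), Finset.sum_filter]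
  refine Finset.sum_congr rfl fun e' _ => ?_
  by_cases hc : P.InClass ℓ i (I.profile u e')
  · have h1 : P.slotOf I u e' = i := hc.2.2
    have h2 : I.pos u e' ≤ (I.order u).symm e :=
      (P.pos_lt_of_slot_lt I u (e := e') (e' := e) (by omega)).le
    rw [if_pos h2]
  · simp [hc]

theorem worth_history :
    P.worth (I.history u ((I.order u).symm e)) (P.slotOf I u e)
      = P.worth (I.profile u) (P.slotOf I u e) := by
  unfold worth
  rw [I.sum_history u _ (fun a => if P.slot a.1 < P.slotOf I u e then a.2.2 else 0),
    Finset.sum_filter]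
  refine Finset.sum_congr rfl fun e' _ => ?_
  by_cases hc : P.slot (I.profile u e').1 < P.slotOf I u e
  · have h2 : I.pos u e' ≤ (I.order u).symm e :=
      (P.pos_lt_of_slot_lt I u (e := e') (e' := e) hc).le
    rw [if_pos h2]
  · simp [hc]

theorem low_history (ℓ : ℤ) {i : ℕ} (hi : i ≤ P.slotOf I u e) :
    P.low (I.history u ((I.order u).symm e)) ℓ i = P.low (I.profile u) ℓ i := by
  induction i with
  | zero => rfl
  | succ i ih => simp only [low]; rw [ih (by omega), P.load_history_of_lt I u e ℓ (by omega)]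

theorem center_history :
    P.center (I.history u ((I.order u).symm e)) (P.slotOf I u e)
      = P.center (I.profile u) (P.slotOf I u e) := by
  rw [center, worth_history, center]

theorem excess_history :
    P.excess (I.history u ((I.order u).symm e)) (P.slotOf I u e)
      = P.excess (I.profile u) (P.slotOf I u e) := by
  funext ℓ; rw [excess, low_history _ _ _ _ _ le_rfl, excess]

open Classical in
/-- The elements of level `ℓ` that arrive in slot `i`. -/
noncomputable def classOf (ℓ : ℤ) (i : ℕ) : Finset (Fin n) :=
  Finset.univ.filter fun e => P.InClass ℓ i (I.profile u e)

theorem mem_classOf {ℓ : ℤ} {i : ℕ} {e : Fin n} : e ∈ P.classOf I u ℓ i ↔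
    Eligible n (I.profile u e) ∧ P.level (I.profile u e) = ℓ ∧ P.slotOf I u e = i := by
  classical
  rw [classOf, Finset.mem_filter]
  exact ⟨fun h => h.2, fun h => ⟨Finset.mem_univ _, h⟩⟩

/-- The capacity of level `ℓ` in slot `i`. -/
noncomputable def capacity (i : ℕ) (ℓ : ℤ) : ℝ :=
  P.alloc (I.profile u) i (P.center (I.profile u) i) ℓ + P.reserve + 1

theorem load_profile (ℓ : ℤ) (i : ℕ) :
    P.load (I.profile u) ℓ i = ∑ e ∈ P.classOf I u ℓ i, I.size e := by
  classical
  rw [load, classOf, Finset.sum_filter]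
  rfl

/-- In its own slot, `e` sees exactly the prefix of its class. This turns the acceptance rule into
an instance of `fitting`. -/
theorem load_history_self :
    P.load (I.history u ((I.order u).symm e)) (P.level (I.profile u e)) (P.slotOf I u e)
      = ∑ e' ∈ (P.classOf I u (P.level (I.profile u e)) (P.slotOf I u e)).filter
          (fun e' => I.pos u e' ≤ I.pos u e), I.size e' := by
  classical
  unfold load
  rw [I.sum_history u _ (fun a => if P.InClass _ _ a then a.2.1 else 0), classOf,
    Finset.filter_filter, Finset.sum_filter, Finset.sum_filter]
  refine Finset.sum_congr rfl fun e' _ => ?_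
  by_cases h1 : I.pos u e' ≤ I.pos u e
  · have h1' : I.pos u e' ≤ (I.order u).symm e := h1
    by_cases h2 : P.InClass (P.level (I.profile u e)) (P.slotOf I u e) (I.profile u e')
    · rw [if_pos h1', if_pos h2, if_pos ⟨h2, h1⟩]; rfl
    · simp [h2]
  · have h1' : ¬ I.pos u e' ≤ (I.order u).symm e := h1
    simp [h1, h1']

/-- The elements selected in level `ℓ` and slot `i`. -/
noncomputable def selectedClass (i : ℕ) (ℓ : ℤ) : Finset (Fin n) :=
  fitting (P.classOf I u ℓ i) (I.pos u) I.size (P.capacity I u i ℓ)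

theorem accepts_iff :
    P.Accepts (I.history u ((I.order u).symm e)) (I.profile u e) ↔
      n * I.size e ≤ 1 ∨ (P.level (I.profile u e) ∈ P.window (I.profile u) (P.slotOf I u e) ∧
        e ∈ P.selectedClass I u (P.slotOf I u e) (P.level (I.profile u e))) := by
  have h1 := P.load_history_self I u e
  have h2 := P.center_history I u e
  have h3 := P.excess_history I u e
  have h4 : e ∈ P.classOf I u (P.level (I.profile u e)) (P.slotOf I u e) ↔
      Eligible n (I.profile u e) := by simp [mem_classOf]
  rw [selectedClass, fitting, Finset.mem_filter, h4, ← h1]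
  unfold Accepts window capacity alloc
  rw [show P.slot (I.profile u e).1 = P.slotOf I u e from rfl, h2, h3,
    show (I.profile u e).2.1 = I.size e from rfl]
  tauto

end Params

/-! ### Size and value of the selected set -/

namespace Params

variable {n : ℕ} (P : Params n) (I : Instance n) (u : Fin n → unitInterval)

open Classical in
/-- The elements selected by the acceptance rule. -/
noncomputable def chosen : Finset (Fin n) :=
  Finset.univ.filter fun e => P.Accepts (I.history u ((I.order u).symm e)) (I.profile u e)

/-- The tiny elements. -/
noncomputable def tiny : Finset (Fin n) := Finset.univ.filter fun e => n * I.size e ≤ 1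

theorem mem_tiny {e : Fin n} : e ∈ tiny I ↔ n * I.size e ≤ 1 := by simp [tiny]

theorem mem_selectedClass {i : ℕ} {ℓ : ℤ} {e : Fin n} (h : e ∈ P.selectedClass I u i ℓ) :
    Eligible n (I.profile u e) ∧ P.level (I.profile u e) = ℓ ∧ P.slotOf I u e = i :=
  (P.mem_classOf I u).1 (Finset.mem_filter.1 h).1

theorem chosen_eq (hT : 0 < P.T) : P.chosen I u = tiny I ∪ ((Finset.range P.T).sigma
    (fun i => P.window (I.profile u) i)).biUnion (fun x => P.selectedClass I u x.1 x.2) := by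
  classical
  ext e
  rw [chosen, Finset.mem_filter, accepts_iff, Finset.mem_union, mem_tiny, Finset.mem_biUnion]
  refine ⟨fun h => h.2.imp id fun h => ⟨⟨P.slotOf I u e, P.level (I.profile u e)⟩, ?_, h.2⟩,
    fun h => ⟨Finset.mem_univ _, h.imp id ?_⟩⟩
  · exact Finset.mem_sigma.2 ⟨Finset.mem_range.2 (P.slot_lt hT _), h.1⟩
  · rintro ⟨⟨i, ℓ⟩, hx, he⟩
    obtain ⟨-, rfl, rfl⟩ := P.mem_selectedClass I u he
    exact ⟨(Finset.mem_sigma.1 hx).2, he⟩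

theorem sum_chosen (hT : 0 < P.T) (F : Fin n → ℝ) : ∑ e ∈ P.chosen I u, F e
    = ∑ e ∈ tiny I, F e + ∑ i ∈ Finset.range P.T, ∑ ℓ ∈ P.window (I.profile u) i,
        ∑ e ∈ P.selectedClass I u i ℓ, F e := by
  classical
  rw [P.chosen_eq I u hT, Finset.sum_union, Finset.sum_biUnion, Finset.sum_sigma]
  · rintro ⟨i, ℓ⟩ - ⟨i', ℓ'⟩ - hne
    refine Finset.disjoint_left.2 fun e he he' => hne ?_
    obtain ⟨-, rfl, rfl⟩ := P.mem_selectedClass I u he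
    obtain ⟨-, h1, h2⟩ := P.mem_selectedClass I u he'
    simp only at h1 h2
    rw [h1, h2]
  · refine Finset.disjoint_left.2 fun e he he' => ?_
    obtain ⟨x, -, hx⟩ := Finset.mem_biUnion.1 he'
    have := (P.mem_selectedClass I u hx).1.1
    exact absurd ((mem_tiny I).1 he) (not_le.2 this)

theorem sum_size_tiny_le : ∑ e ∈ tiny I, I.size e ≤ 1 := by
  rcases Nat.eq_zero_or_pos n with rfl | hn
  · simp [tiny]
  have hn' : (0 : ℝ) < n := by exact_mod_cast hn
  calc ∑ e ∈ tiny I, I.size e ≤ ∑ e ∈ tiny I, (1 / n : ℝ) :=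
        Finset.sum_le_sum fun e he => by
          rw [le_div_iff₀ hn', mul_comm]; exact (mem_tiny I).1 he
    _ ≤ ∑ _e : Fin n, (1 / n : ℝ) :=
        Finset.sum_le_sum_of_subset_of_nonneg (Finset.subset_univ _) fun _ _ _ => by positivity
    _ = 1 := by simp; field_simp

theorem excess_nonneg {ι : Type*} [Fintype ι] (h : ι → Arrival) (i : ℕ) (ℓ : ℤ) :
    0 ≤ P.excess h i ℓ := le_max_right _ _

theorem alloc_nonneg {ι : Type*} [Fintype ι] (h : ι → Arrival) (i : ℕ) (c ℓ : ℤ) :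
    0 ≤ P.alloc h i c ℓ := greedy_nonneg (P.excess_nonneg h i) ℓ

theorem window_eq {ι : Type*} [Fintype ι] (h : ι → Arrival) (i : ℕ) : P.window h i =
    Finset.Icc (P.center h i + P.radius + 1 - ((2 * P.radius + 1 : ℕ) : ℤ))
      (P.center h i + P.radius) := by
  unfold window; congr 1; push_cast; ring

theorem sum_alloc_le {ι : Type*} [Fintype ι] (h : ι → Arrival) (i : ℕ) (hB : 0 ≤ P.budget) :
    ∑ ℓ ∈ P.window h i, P.alloc h i (P.center h i) ℓ ≤ P.budget := by
  rw [window_eq]; exact sum_greedy_le hB (P.excess_nonneg h i) _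

theorem card_window {ι : Type*} [Fintype ι] (h : ι → Arrival) (i : ℕ) :
    (P.window h i).card = 2 * P.radius + 1 := by
  rw [window, Int.card_Icc]; omega

/-- The bound holds wherever the windows are centred, including the default centre `0` while `worth`
is `0`: the allocations of a slot never exceed its budget, and the reserves are paid for exactly `2
* radius + 1` levels. -/
theorem sum_size_chosen_le (hT : 0 < P.T) (hB : 0 ≤ P.budget) (hf : 0 ≤ P.reserve) :
    ∑ e ∈ P.chosen I u, I.size e
      ≤ 1 + P.T * (P.budget + (2 * P.radius + 1) * (P.reserve + 1)) := by
  rw [P.sum_chosen I u hT]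
  refine add_le_add (sum_size_tiny_le I) ?_
  calc ∑ i ∈ Finset.range P.T, ∑ ℓ ∈ P.window (I.profile u) i,
        ∑ e ∈ P.selectedClass I u i ℓ, I.size e
      ≤ ∑ i ∈ Finset.range P.T, ∑ ℓ ∈ P.window (I.profile u) i, P.capacity I u i ℓ := by
        refine Finset.sum_le_sum fun i _ => Finset.sum_le_sum fun ℓ _ => ?_
        refine sum_fitting_le _ _ _ ?_ I.size_nonneg
        have := P.alloc_nonneg (I.profile u) i (P.center (I.profile u) i) ℓ
        unfold capacity; linarith
    _ ≤ ∑ i ∈ Finset.range P.T, (P.budget + (2 * P.radius + 1) * (P.reserve + 1)) := by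
        refine Finset.sum_le_sum fun i _ => ?_
        simp only [capacity, add_assoc]
        rw [Finset.sum_add_distrib, Finset.sum_const, card_window, nsmul_eq_mul]
        push_cast
        exact add_le_add (P.sum_alloc_le (I.profile u) i hB) le_rfl
    _ = _ := by rw [Finset.sum_const, Finset.card_range, nsmul_eq_mul]

/-- The smallest density of level `ℓ`. -/
noncomputable def density (ℓ : ℤ) : ℝ := (1 + P.δ) ^ ℓ

variable {P}

theorem density_pos (hδ : 0 < P.δ) (ℓ : ℤ) : 0 < P.density ℓ := zpow_pos (by linarith) _

theorem density_mono (hδ : 0 < P.δ) : Monotone P.density := fun _ _ h =>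
  zpow_le_zpow_right₀ (by linarith) h

theorem size_pos_of_eligible {a : Arrival} (ha : Eligible n a) : 0 < a.2.1 := by
  by_contra h
  have : (n : ℝ) * a.2.1 ≤ 0 := mul_nonpos_of_nonneg_of_nonpos (Nat.cast_nonneg n) (not_lt.1 h)
  linarith [ha.1]

theorem density_level_mul_le (hδ : 0 < P.δ) {a : Arrival} (ha : Eligible n a) :
    P.density (P.level a) * a.2.1 ≤ a.2.2 := by
  have hs := size_pos_of_eligible ha
  have hx : 0 < a.2.2 / a.2.1 := div_pos ha.2 hs
  rw [← le_div_iff₀ hs, density, ← Real.rpow_intCast]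
  calc (1 + P.δ) ^ ((P.level a : ℤ) : ℝ) ≤ (1 + P.δ) ^ Real.logb (1 + P.δ) (a.2.2 / a.2.1) :=
        Real.rpow_le_rpow_of_exponent_le (by linarith) (Int.floor_le _)
    _ = _ := Real.rpow_logb (by linarith) (by linarith) hx

theorem value_le_density_level_mul (hδ : 0 < P.δ) {a : Arrival} (ha : Eligible n a) :
    a.2.2 ≤ (1 + P.δ) * (P.density (P.level a) * a.2.1) := by
  have hs := size_pos_of_eligible ha
  have hx : 0 < a.2.2 / a.2.1 := div_pos ha.2 hs
  rw [← mul_assoc, ← div_le_iff₀ hs, density, mul_comm, ← zpow_add_one₀ (by linarith),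
    ← Real.rpow_intCast]
  calc a.2.2 / a.2.1 = (1 + P.δ) ^ Real.logb (1 + P.δ) (a.2.2 / a.2.1) :=
        (Real.rpow_logb (by linarith) (by linarith) hx).symm
    _ ≤ _ := Real.rpow_le_rpow_of_exponent_le (by linarith) (by
        push_cast; exact (Int.lt_floor_add_one _).le)

theorem load_nonneg (ℓ : ℤ) (i : ℕ) : 0 ≤ P.load (I.profile u) ℓ i := by
  rw [load_profile]; exact Finset.sum_nonneg fun e _ => I.size_nonneg e

/-- In every level and slot, the selected value is at least that of the capacity used. -/
theorem le_value_chosen (hδ : 0 < P.δ) (hT : 0 < P.T) :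
    ∑ e ∈ tiny I, I.value e + ∑ i ∈ Finset.range P.T, ∑ ℓ ∈ P.window (I.profile u) i,
      P.density ℓ * min (P.load (I.profile u) ℓ i)
        (P.alloc (I.profile u) i (P.center (I.profile u) i) ℓ + P.reserve)
      ≤ ∑ e ∈ P.chosen I u, I.value e := by
  rw [P.sum_chosen I u hT]
  refine add_le_add le_rfl (Finset.sum_le_sum fun i _ => Finset.sum_le_sum fun ℓ _ => ?_)
  -- The extra unit in `capacity` compensates for the `- 1` here.
  have h := le_sum_fitting (P.classOf I u ℓ i) (I.pos_injective u) I.size (P.capacity I u i ℓ)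
    I.size_nonneg I.size_le_one
  rw [← load_profile, capacity, add_sub_cancel_right, ← capacity] at h
  refine (mul_le_mul_of_nonneg_left h (density_pos hδ ℓ).le).trans ?_
  rw [Finset.mul_sum]
  refine Finset.sum_le_sum fun e he => ?_
  obtain ⟨h1, rfl, -⟩ := P.mem_selectedClass I u he
  exact density_level_mul_le hδ h1

end Params

/-! ### Drops of a running minimum -/

section RunningMinimum

variable {N δ f : ℝ} {m s : ℕ → ℝ}

/-- A running minimum that starts at `N` drops by a factor `1 - δ` from a level `≥ f ≥ 1` at most
`log N / δ + 1` times. -/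
theorem card_drops_le (hδ : 0 < δ) (hδ1 : δ < 1) (hf : 1 ≤ f) (hN : 1 ≤ N) (h0 : m 0 = N)
    (hm : ∀ i, m (i + 1) = min (m i) (s i)) (T : ℕ) :
    (((Finset.range T).filter fun i => f ≤ m i ∧ s i < (1 - δ) * m i).card : ℝ)
      ≤ Real.log N / δ + 1 := by
  classical
  have hpos : 0 < 1 - δ := by linarith
  have hlog : 0 ≤ Real.log N := Real.log_nonneg hN
  have key : ∀ T, m T ≤ N * (1 - δ) ^ ((Finset.range T).filter
      fun i => f ≤ m i ∧ s i < (1 - δ) * m i).card ∧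
      (((Finset.range T).filter fun i => f ≤ m i ∧ s i < (1 - δ) * m i).card : ℝ)
        ≤ Real.log N / δ + 1 := by
    intro T
    induction T with
    | zero => simp [h0]; positivity
    | succ T ih =>
      rw [Finset.range_add_one, Finset.filter_insert]
      split_ifs with h
      · rw [Finset.card_insert_of_notMem (by simp)]
        set c := ((Finset.range T).filter fun i => f ≤ m i ∧ s i < (1 - δ) * m i).card
        constructor
        · rw [hm, pow_succ]
          calc min (m T) (s T) ≤ (1 - δ) * m T := (min_le_right _ _).trans h.2.le
            _ ≤ (1 - δ) * (N * (1 - δ) ^ c) := mul_le_mul_of_nonneg_left ih.1 hpos.le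
            _ = _ := by ring
        -- The minimum before this drop is still at least `f ≥ 1`, which bounds the number `c` of
        -- earlier drops by `log N / δ`. The present drop is the `+ 1`.
        · have h1 : 1 ≤ N * (1 - δ) ^ c := (hf.trans h.1).trans ih.1
          have h2 : (1 - δ) ^ c ≤ Real.exp (-(δ * c)) := by
            calc (1 - δ) ^ c ≤ (Real.exp (-δ)) ^ c :=
                  pow_le_pow_left₀ hpos.le (by have := Real.add_one_le_exp (-δ); linarith) _
              _ = _ := by rw [← Real.exp_nat_mul]; ring_nf
          have h3 : Real.exp (δ * c) ≤ N := by
            have := h1.trans (mul_le_mul_of_nonneg_left h2 (by linarith))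
            rw [Real.exp_neg, ← div_eq_mul_inv, one_le_div (Real.exp_pos _)] at this
            exact this
          have h4 : δ * c ≤ Real.log N := (Real.le_log_iff_exp_le (by linarith)).2 h3
          push_cast
          rw [add_le_add_iff_right, le_div_iff₀ hδ]
          linarith
      · refine ⟨?_, ih.2⟩
        rw [hm]
        exact (min_le_left _ _).trans ih.1
  exact (key T).2

theorem le_running_min {y : ℝ} (h0 : y ≤ m 0) (hm : ∀ i, m (i + 1) = min (m i) (s i)) (i : ℕ)
    (h : ∀ j < i, y ≤ s j) : y ≤ m i := by
  induction i with
  | zero => exact h0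
  | succ i ih => rw [hm]; exact le_min (ih fun j hj => h j (by omega)) (h i (by omega))

end RunningMinimum

/-! ### The gain of a single slot -/

section SlotGain

variable {W L : Finset ℤ} {τ s a m r q : ℤ → ℝ} {f δ B : ℝ} {steady : ℤ → Prop}

open Classical in
/-- The gain of a slot in which no load has dropped. -/
theorem le_gain_of_no_drop (hL : L ⊆ W) (hδ : 0 < δ) (hδ1 : δ < 1) (hf : 0 ≤ f)
    (hτ : ∀ ℓ, 0 ≤ τ ℓ) (hs : ∀ ℓ, 0 ≤ s ℓ) (ha : ∀ ℓ, 0 ≤ a ℓ)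
    (ham : ∀ ℓ, a ℓ ≤ max (m ℓ - f) 0)
    (hgreedy : ∀ b : ℤ → ℝ, (∀ ℓ, 0 ≤ b ℓ) → (∀ ℓ, b ℓ ≤ max (m ℓ - f) 0) →
      ∑ ℓ ∈ W, b ℓ ≤ B → ∑ ℓ ∈ W, τ ℓ * b ℓ ≤ ∑ ℓ ∈ W, τ ℓ * a ℓ)
    (hr : ∀ ℓ, 0 ≤ r ℓ) (hrs : ∀ ℓ, r ℓ ≤ (1 + δ) * s ℓ) (hq : ∀ ℓ, 0 ≤ q ℓ)
    (hst : ∀ ℓ ∈ L, steady ℓ → (1 - δ) * q ℓ ≤ r ℓ ∧ r ℓ ≤ (1 + δ) * q ℓ ∧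
      (1 - δ) / (1 + δ) * q ℓ ≤ m ℓ)
    (hqB : ∑ ℓ ∈ L, (1 - δ) / (1 + δ) * q ℓ ≤ B)
    (hdrop : ∀ ℓ ∈ W, m ℓ < f ∨ (1 - δ) * m ℓ ≤ s ℓ) :
    ((1 - δ) / (1 + δ)) ^ 2 * (∑ ℓ ∈ L, τ ℓ * r ℓ
      - ∑ ℓ ∈ L with ¬ steady ℓ, τ ℓ * max (r ℓ - f) 0) ≤ ∑ ℓ ∈ W, τ ℓ * min (s ℓ) (a ℓ + f) := by
  -- The competitor of the greedy allocation: what the steady levels need beyond the reserve.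
  set b : ℤ → ℝ := fun ℓ =>
    if ℓ ∈ L ∧ steady ℓ then max ((1 - δ) / (1 + δ) * q ℓ - f) 0 else 0 with hb
  set ρ := (1 - δ) / (1 + δ) with hρ
  have hρ0 : 0 ≤ ρ := div_nonneg (by linarith) (by linarith)
  have hρδ : ρ * (1 + δ) = 1 - δ := by rw [hρ]; field_simp
  have hρ1 : ρ ≤ 1 - δ := by nlinarith
  have hb0 : ∀ ℓ, 0 ≤ b ℓ := fun ℓ => by
    simp only [hb]; split_ifs; exacts [le_max_right _ _, le_rfl]
  have hbm : ∀ ℓ, b ℓ ≤ max (m ℓ - f) 0 := fun ℓ => by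
    simp only [hb]; split_ifs with h
    · exact max_le_max (by linarith [(hst ℓ h.1 h.2).2.2]) le_rfl
    · exact le_max_right _ _
  have hbB : ∑ ℓ ∈ W, b ℓ ≤ B := by
    refine le_trans ?_ hqB
    have : ∑ ℓ ∈ W, b ℓ = ∑ ℓ ∈ L, b ℓ := by
      refine (Finset.sum_subset hL fun ℓ _ hℓ => ?_).symm
      simp [hb, hℓ]
    rw [this]
    refine Finset.sum_le_sum fun ℓ _ => ?_
    have := mul_nonneg hρ0 (hq ℓ)
    simp only [hb]; split_ifs
    · exact max_le (by linarith) this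
    · exact this
  -- If `m ℓ ≥ f`, then `a ℓ + f ≤ m ℓ`, and without a drop `(1 - δ) * m ℓ ≤ s ℓ`. Otherwise `a ℓ =
  -- 0` and the reserve alone gives the bound.
  have h1 : ∀ ℓ ∈ W, (1 - δ) * (a ℓ + min f (s ℓ)) ≤ min (s ℓ) (a ℓ + f) := by
    intro ℓ hℓ
    have hsl := hs ℓ
    have hal := ha ℓ
    have h2 := ham ℓ
    have hmin : 0 ≤ min f (s ℓ) := le_min hf hsl
    refine le_min ?_ ?_
    · rcases hdrop ℓ hℓ with h | h
      · rw [max_eq_right (by linarith)] at h2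
        have : a ℓ = 0 := le_antisymm h2 hal
        rw [this, zero_add]
        nlinarith [min_le_right f (s ℓ)]
      · rcases le_total (m ℓ - f) 0 with h' | h'
        · rw [max_eq_right h'] at h2
          have : a ℓ = 0 := le_antisymm h2 hal
          rw [this, zero_add]
          nlinarith [min_le_right f (s ℓ)]
        · rw [max_eq_left h'] at h2
          calc (1 - δ) * (a ℓ + min f (s ℓ)) ≤ (1 - δ) * m ℓ :=
                mul_le_mul_of_nonneg_left (by linarith [min_le_left f (s ℓ)]) (by linarith)
            _ ≤ s ℓ := h
    · nlinarith [min_le_left f (s ℓ)]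
  -- A steady level is covered by `b` and the reserve together. For any other level the left side
  -- only involves `min (r ℓ) f`, which the reserve covers up to the factor `1 + δ`.
  have h2 : ∀ ℓ ∈ L, ρ ^ 2 * (r ℓ - if ¬ steady ℓ then max (r ℓ - f) 0 else 0)
      ≤ (1 - δ) * (b ℓ + min f (s ℓ)) := by
    intro ℓ hℓ
    have hsl := hs ℓ
    have hrl := hr ℓ
    by_cases hst' : steady ℓ
    · obtain ⟨h3, h4, h5⟩ := hst ℓ hℓ hst'
      have hqs : ρ * q ℓ ≤ s ℓ := by
        have : (1 - δ) * q ℓ ≤ (1 + δ) * s ℓ := h3.trans (hrs ℓ)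
        rw [← hρδ] at this
        nlinarith
      have hbq : ρ * q ℓ ≤ b ℓ + min f (s ℓ) := by
        have hbl : b ℓ = max (ρ * q ℓ - f) 0 := by simp [hb, hℓ, hst']
        rw [hbl]
        rcases le_total f (s ℓ) with h | h
        · rw [min_eq_left h]; linarith [le_max_left (ρ * q ℓ - f) 0]
        · rw [min_eq_right h]; linarith [le_max_right (ρ * q ℓ - f) 0]
      simp only [hst', not_true_eq_false, if_false, sub_zero]
      calc ρ ^ 2 * r ℓ ≤ ρ ^ 2 * ((1 + δ) * q ℓ) := mul_le_mul_of_nonneg_left h4 (by positivity)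
        _ = (1 - δ) * (ρ * q ℓ) := by rw [← hρδ]; ring
        _ ≤ _ := mul_le_mul_of_nonneg_left hbq (by linarith)
    · have hbl : b ℓ = 0 := by simp [hb, hst']
      simp only [hst', not_false_eq_true, if_true, hbl, zero_add]
      have h6 : r ℓ - max (r ℓ - f) 0 ≤ (1 + δ) * min f (s ℓ) := by
        rcases le_total f (s ℓ) with h | h
        · rw [min_eq_left h]; nlinarith [le_max_left (r ℓ - f) 0]
        · rw [min_eq_right h]; nlinarith [le_max_right (r ℓ - f) 0, hrs ℓ]
      have hmin : 0 ≤ min f (s ℓ) := le_min hf hsl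
      calc ρ ^ 2 * (r ℓ - max (r ℓ - f) 0) ≤ ρ ^ 2 * ((1 + δ) * min f (s ℓ)) :=
            mul_le_mul_of_nonneg_left h6 (by positivity)
        _ = (ρ * (1 + δ)) * (ρ * min f (s ℓ)) := by ring
        _ ≤ (1 - δ) * min f (s ℓ) := by
            rw [hρδ]
            exact mul_le_mul_of_nonneg_left (by nlinarith) (by linarith)
  calc ρ ^ 2 * (∑ ℓ ∈ L, τ ℓ * r ℓ - ∑ ℓ ∈ L with ¬ steady ℓ, τ ℓ * max (r ℓ - f) 0)
      = ∑ ℓ ∈ L, τ ℓ * (ρ ^ 2 * (r ℓ - if ¬ steady ℓ then max (r ℓ - f) 0 else 0)) := by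
        rw [Finset.sum_filter, ← Finset.sum_sub_distrib, Finset.mul_sum]
        refine Finset.sum_congr rfl fun ℓ _ => ?_
        split_ifs <;> ring
    _ ≤ ∑ ℓ ∈ L, τ ℓ * ((1 - δ) * (b ℓ + min f (s ℓ))) :=
        Finset.sum_le_sum fun ℓ hℓ => mul_le_mul_of_nonneg_left (h2 ℓ hℓ) (hτ ℓ)
    _ ≤ ∑ ℓ ∈ W, τ ℓ * ((1 - δ) * (b ℓ + min f (s ℓ))) :=
        Finset.sum_le_sum_of_subset_of_nonneg hL fun ℓ _ _ => mul_nonneg (hτ ℓ)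
          (mul_nonneg (by linarith) (add_nonneg (hb0 ℓ) (le_min hf (hs ℓ))))
    _ = (1 - δ) * (∑ ℓ ∈ W, τ ℓ * b ℓ) + ∑ ℓ ∈ W, τ ℓ * ((1 - δ) * min f (s ℓ)) := by
        rw [Finset.mul_sum, ← Finset.sum_add_distrib]
        exact Finset.sum_congr rfl fun ℓ _ => by ring
    _ ≤ (1 - δ) * (∑ ℓ ∈ W, τ ℓ * a ℓ) + ∑ ℓ ∈ W, τ ℓ * ((1 - δ) * min f (s ℓ)) := by
        have := mul_le_mul_of_nonneg_left (hgreedy b hb0 hbm hbB) (by linarith : 0 ≤ 1 - δ)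
        linarith
    _ = ∑ ℓ ∈ W, τ ℓ * ((1 - δ) * (a ℓ + min f (s ℓ))) := by
        rw [Finset.mul_sum, ← Finset.sum_add_distrib]
        exact Finset.sum_congr rfl fun ℓ _ => by ring
    _ ≤ _ := Finset.sum_le_sum fun ℓ hℓ => mul_le_mul_of_nonneg_left (h1 ℓ hℓ) (hτ ℓ)

open Classical in
/-- The gain of an arbitrary slot. -/
theorem le_gain_of_drop (hL : L ⊆ W) (hδ : 0 < δ) (hδ1 : δ < 1) (hf : 0 ≤ f)
    (hτ : ∀ ℓ, 0 ≤ τ ℓ) (hs : ∀ ℓ, 0 ≤ s ℓ) (ha : ∀ ℓ, 0 ≤ a ℓ)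
    (hrs : ∀ ℓ, r ℓ ≤ (1 + δ) * s ℓ) (hq : ∀ ℓ, 0 ≤ q ℓ)
    (hst : ∀ ℓ ∈ L, steady ℓ → r ℓ ≤ (1 + δ) * q ℓ) :
    ((1 - δ) / (1 + δ)) ^ 2 * (∑ ℓ ∈ L, τ ℓ * r ℓ
      - ∑ ℓ ∈ L with ¬ steady ℓ, τ ℓ * max (r ℓ - f) 0) - 2 * ∑ ℓ ∈ L, τ ℓ * q ℓ
      ≤ ∑ ℓ ∈ W, τ ℓ * min (s ℓ) (a ℓ + f) := by
  set ρ := (1 - δ) / (1 + δ) with hρ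
  have hρ0 : 0 ≤ ρ := div_nonneg (by linarith) (by linarith)
  have hρδ : ρ * (1 + δ) = 1 - δ := by rw [hρ]; field_simp
  have hρ1 : ρ ≤ 1 := by nlinarith
  have hρ2 : ρ ^ 2 ≤ 1 := by nlinarith
  calc ρ ^ 2 * (∑ ℓ ∈ L, τ ℓ * r ℓ - ∑ ℓ ∈ L with ¬ steady ℓ, τ ℓ * max (r ℓ - f) 0)
      - 2 * ∑ ℓ ∈ L, τ ℓ * q ℓ
      = ∑ ℓ ∈ L, τ ℓ * (ρ ^ 2 * (r ℓ - if ¬ steady ℓ then max (r ℓ - f) 0 else 0)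
          - 2 * q ℓ) := by
        rw [Finset.sum_filter, ← Finset.sum_sub_distrib, Finset.mul_sum, Finset.mul_sum,
          ← Finset.sum_sub_distrib]
        refine Finset.sum_congr rfl fun ℓ _ => ?_
        split_ifs <;> ring
    _ ≤ ∑ ℓ ∈ L, τ ℓ * min (s ℓ) (a ℓ + f) := by
        refine Finset.sum_le_sum fun ℓ hℓ => mul_le_mul_of_nonneg_left ?_ (hτ ℓ)
        have hsl := hs ℓ
        have hal := ha ℓ
        have hql := hq ℓ
        have hmin : min f (s ℓ) ≤ min (s ℓ) (a ℓ + f) :=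
          le_min (min_le_right _ _) ((min_le_left _ _).trans (by linarith))
        have hmin0 : 0 ≤ min f (s ℓ) := le_min hf hsl
        by_cases h : steady ℓ
        -- The subtracted `2 * q ℓ` already outweighs `ρ ^ 2 * r ℓ ≤ (1 + δ) * q ℓ`.
        · simp only [h, not_true_eq_false, if_false, sub_zero]
          have h1 : ρ ^ 2 * r ℓ ≤ ρ ^ 2 * ((1 + δ) * q ℓ) :=
            mul_le_mul_of_nonneg_left (hst ℓ hℓ h) (by positivity)
          have h2 : ρ ^ 2 * ((1 + δ) * q ℓ) ≤ 1 * ((1 + δ) * q ℓ) :=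
            mul_le_mul_of_nonneg_right hρ2 (by positivity)
          nlinarith
        · simp only [h, not_false_eq_true, if_true]
          have h6 : r ℓ - max (r ℓ - f) 0 ≤ (1 + δ) * min f (s ℓ) := by
            rcases le_total f (s ℓ) with h | h
            · rw [min_eq_left h]; nlinarith [le_max_left (r ℓ - f) 0]
            · rw [min_eq_right h]; nlinarith [le_max_right (r ℓ - f) 0, hrs ℓ]
          have h7 : ρ ^ 2 * (r ℓ - max (r ℓ - f) 0) ≤ ρ ^ 2 * ((1 + δ) * min f (s ℓ)) :=
            mul_le_mul_of_nonneg_left h6 (by positivity)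
          have h8 : ρ ^ 2 * ((1 + δ) * min f (s ℓ)) = (1 - δ) * (ρ * min f (s ℓ)) := by
            rw [← hρδ]; ring
          have h9 : ρ * min f (s ℓ) ≤ min f (s ℓ) := by nlinarith
          nlinarith [mul_nonneg hρ0 hmin0]
    _ ≤ _ := Finset.sum_le_sum_of_subset_of_nonneg hL fun ℓ _ _ =>
        mul_nonneg (hτ ℓ) (le_min (hs ℓ) (add_nonneg (ha ℓ) hf))

end SlotGain

/-! ### Comparison with a weighted green set, for fixed arrival times -/

namespace Params

variable {n : ℕ} (P : Params n) (I : Instance n)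

/-- The density level of the element `e`. -/
noncomputable def levelOf (e : Fin n) : ℤ := ⌊Real.logb (1 + P.δ) (I.value e / I.size e)⌋

theorem level_profile (u : Fin n → unitInterval) (e : Fin n) :
    P.level (I.profile u e) = P.levelOf I e := rfl

/-- A set `R` of green elements with weights `w` that the algorithm is compared with; `H` is a
finite set of levels that contains the windows of all slots after the first element of `R`. -/
structure Relevant (R : Finset (Fin n)) (w : Fin n → ℝ) (H : Finset ℤ) : Prop where
  subset : R ⊆ I.green
  large : ∀ e ∈ R, 1 < n * I.size e
  value_pos : ∀ e ∈ R, 0 < I.value e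
  weight_nonneg : ∀ e, 0 ≤ w e
  weight_le : ∀ e ∈ R, w e ≤ I.value e
  size_le : (1 - P.δ) * ∑ e ∈ R, I.size e ≤ P.T * P.budget
  level_mem : ∀ u i, (∃ e ∈ R, P.slot (u e) < i) →
    ∀ e ∈ R, P.levelOf I e ∈ P.window (I.profile u) i
  window_subset : ∀ u i, (∃ e ∈ R, P.slot (u e) < i) → P.window (I.profile u) i ⊆ H

variable (R : Finset (Fin n)) (w : Fin n → ℝ)

/-- The size of the element `e` at which its weight has the smallest density of its level. -/
noncomputable def effSize (e : Fin n) : ℝ := w e / P.density (P.levelOf I e)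

/-- The effective size of the elements of `R` of level `ℓ` that arrive in slot `i`. -/
noncomputable def relLoad (u : Fin n → unitInterval) (ℓ : ℤ) (i : ℕ) : ℝ :=
  ∑ e ∈ R with P.levelOf I e = ℓ, if P.slot (u e) = i then P.effSize I w e else 0

/-- The expectation of the effective size of the elements of `R` of level `ℓ` in a slot. -/
noncomputable def relMean (ℓ : ℤ) : ℝ := (∑ e ∈ R with P.levelOf I e = ℓ, P.effSize I w e) / P.T

/-- The elements of `R` of level `ℓ` are spread evenly over the slots. -/
def Steady (u : Fin n → unitInterval) (ℓ : ℤ) : Prop :=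
  ∀ i < P.T, (1 - P.δ) * P.relMean I R w ℓ ≤ P.relLoad I R w u ℓ i ∧
    P.relLoad I R w u ℓ i ≤ (1 + P.δ) * P.relMean I R w ℓ

variable {P I R w} {H : Finset ℤ}

namespace Relevant

variable (hR : P.Relevant I R w H) (hδ : 0 < P.δ) (u : Fin n → unitInterval)
include hR

theorem slotOf_eq {e : Fin n} (he : e ∈ R) : P.slotOf I u e = P.slot (u e) := by
  rw [slotOf, Instance.arrivalTime, if_pos (hR.subset he)]

theorem eligible {e : Fin n} (he : e ∈ R) : Eligible n (I.profile u e) :=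
  ⟨hR.large e he, hR.value_pos e he⟩

include hδ

omit hR in
theorem density_mul_effSize (e : Fin n) : P.density (P.levelOf I e) * P.effSize I w e = w e := by
  rw [effSize, mul_div_cancel₀ _ (density_pos hδ _).ne']

theorem effSize_nonneg (e : Fin n) : 0 ≤ P.effSize I w e :=
  div_nonneg (hR.weight_nonneg e) (density_pos hδ _).le

theorem effSize_le {e : Fin n} (he : e ∈ R) : P.effSize I w e ≤ (1 + P.δ) * I.size e := by
  rw [effSize, div_le_iff₀ (density_pos hδ _)]
  refine (hR.weight_le e he).trans ?_
  have := value_le_density_level_mul (P := P) hδ (hR.eligible (fun _ => 0) he)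
  rw [level_profile] at this
  calc I.value e ≤ (1 + P.δ) * (P.density (P.levelOf I e) * I.size e) := this
    _ = _ := by ring

theorem relLoad_nonneg (ℓ : ℤ) (i : ℕ) : 0 ≤ P.relLoad I R w u ℓ i :=
  Finset.sum_nonneg fun e _ => by
    split_ifs
    exacts [hR.effSize_nonneg hδ e, le_rfl]

theorem relMean_nonneg (ℓ : ℤ) : 0 ≤ P.relMean I R w ℓ :=
  div_nonneg (Finset.sum_nonneg fun e _ => hR.effSize_nonneg hδ e) (Nat.cast_nonneg _)

/-- Red elements only increase the load and cutting weights only decreases the effective one; `1 +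
δ` is the width of a level. -/
theorem relLoad_le (ℓ : ℤ) (i : ℕ) :
    P.relLoad I R w u ℓ i ≤ (1 + P.δ) * P.load (I.profile u) ℓ i := by
  classical
  rw [load_profile, Finset.mul_sum, relLoad, ← Finset.sum_filter, Finset.filter_filter]
  calc ∑ e ∈ R with P.levelOf I e = ℓ ∧ P.slot (u e) = i, P.effSize I w e
      ≤ ∑ e ∈ R with P.levelOf I e = ℓ ∧ P.slot (u e) = i, (1 + P.δ) * I.size e :=
        Finset.sum_le_sum fun e he => hR.effSize_le hδ (Finset.mem_filter.1 he).1
    _ ≤ _ := by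
        refine Finset.sum_le_sum_of_subset_of_nonneg ?_
          fun e _ _ => mul_nonneg (by linarith) (I.size_nonneg e)
        intro e he
        obtain ⟨heR, h1, h2⟩ := Finset.mem_filter.1 he
        exact (P.mem_classOf I u).2 ⟨hR.eligible u heR, h1, by rw [hR.slotOf_eq u heR, h2]⟩

theorem sum_relMean : P.T * ∑ ℓ ∈ R.image (P.levelOf I), P.relMean I R w ℓ
    ≤ (1 + P.δ) * ∑ e ∈ R, I.size e := by
  rw [Finset.mul_sum]
  calc ∑ ℓ ∈ R.image (P.levelOf I), P.T * P.relMean I R w ℓ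
      ≤ ∑ ℓ ∈ R.image (P.levelOf I), ∑ e ∈ R with P.levelOf I e = ℓ, P.effSize I w e := by
        refine Finset.sum_le_sum fun ℓ _ => ?_
        rcases Nat.eq_zero_or_pos P.T with h | h
        · rw [h, Nat.cast_zero, zero_mul]
          exact Finset.sum_nonneg fun e _ => hR.effSize_nonneg hδ e
        · have : (P.T : ℝ) ≠ 0 := by positivity
          rw [relMean, mul_div_cancel₀ _ this]
    _ = ∑ e ∈ R, P.effSize I w e :=
        Finset.sum_fiberwise_of_maps_to (fun e he => Finset.mem_image_of_mem _ he) _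
    _ ≤ _ := by
        rw [Finset.mul_sum]; exact Finset.sum_le_sum fun e he => hR.effSize_le hδ he

omit hR in
theorem sum_density_mul_relMean :
    ∑ ℓ ∈ R.image (P.levelOf I), P.density ℓ * P.relMean I R w ℓ = (∑ e ∈ R, w e) / P.T := by
  rw [← Finset.sum_fiberwise_of_maps_to (fun e he => Finset.mem_image_of_mem (P.levelOf I) he) w,
    Finset.sum_div]
  refine Finset.sum_congr rfl fun ℓ _ => ?_
  rw [relMean, ← mul_div_assoc, Finset.mul_sum]
  congr 1
  refine Finset.sum_congr rfl fun e he => ?_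
  rw [← (Finset.mem_filter.1 he).2, density_mul_effSize hδ]

omit hR in
theorem sum_density_mul_relLoad (i : ℕ) :
    ∑ ℓ ∈ R.image (P.levelOf I), P.density ℓ * P.relLoad I R w u ℓ i
      = ∑ e ∈ R, if P.slot (u e) = i then w e else 0 := by
  rw [← Finset.sum_fiberwise_of_maps_to (fun e he => Finset.mem_image_of_mem (P.levelOf I) he)]
  refine Finset.sum_congr rfl fun ℓ _ => ?_
  rw [relLoad, Finset.mul_sum]
  refine Finset.sum_congr rfl fun e he => ?_
  split_ifs
  · rw [← (Finset.mem_filter.1 he).2, density_mul_effSize hδ]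
  · simp

omit hR hδ in
theorem load_le (ℓ : ℤ) (i : ℕ) : P.load (I.profile u) ℓ i ≤ n := by
  rw [load_profile]
  calc ∑ e ∈ P.classOf I u ℓ i, I.size e ≤ ∑ e ∈ P.classOf I u ℓ i, (1 : ℝ) :=
        Finset.sum_le_sum fun e _ => I.size_le_one e
    _ = (P.classOf I u ℓ i).card := by simp
    _ ≤ n := by exact_mod_cast (Finset.card_le_univ _).trans_eq (Fintype.card_fin n)

open Classical in
/-- The slots in which the load of some level of `H` drops. -/
noncomputable def _root_.ByzantineKnapsack.Params.dropSlots (P : Params n) (I : Instance n)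
    (H : Finset ℤ) (u : Fin n → unitInterval) : Finset ℕ :=
  H.biUnion fun ℓ => (Finset.range P.T).filter fun i =>
    P.reserve ≤ P.low (I.profile u) ℓ i ∧
      P.load (I.profile u) ℓ i < (1 - P.δ) * P.low (I.profile u) ℓ i

omit hR in
theorem card_dropSlots_le (hδ1 : P.δ < 1) (hf : 1 ≤ P.reserve) (hn : 1 ≤ n) :
    ((P.dropSlots I H u).card : ℝ) ≤ H.card * (Real.log n / P.δ + 1) := by
  classical
  calc ((P.dropSlots I H u).card : ℝ) ≤ ((∑ ℓ ∈ H, ((Finset.range P.T).filter fun i =>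
        P.reserve ≤ P.low (I.profile u) ℓ i ∧
          P.load (I.profile u) ℓ i < (1 - P.δ) * P.low (I.profile u) ℓ i).card : ℕ) : ℝ) := by
        exact_mod_cast Finset.card_biUnion_le
    _ ≤ ∑ ℓ ∈ H, (Real.log n / P.δ + 1) := by
        push_cast
        exact Finset.sum_le_sum fun ℓ _ => card_drops_le (N := n) hδ hδ1 hf
          (by exact_mod_cast hn) rfl (fun i => rfl) P.T
    _ = _ := by rw [Finset.sum_const, nsmul_eq_mul]

open Classical in
/-- The loss caused by the levels that are not spread evenly. -/
noncomputable def _root_.ByzantineKnapsack.Params.unsteadyLoss (P : Params n) (I : Instance n)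
    (R : Finset (Fin n)) (w : Fin n → ℝ) (u : Fin n → unitInterval) : ℝ :=
  ∑ ℓ ∈ R.image (P.levelOf I), P.density ℓ * ((if P.Steady I R w u ℓ then 0 else 1) *
    ∑ i ∈ Finset.range P.T, max (P.relLoad I R w u ℓ i - P.reserve) 0)

-- Once an element of `R` has arrived in an earlier slot, the window contains all levels of `R`. A
-- slot without a drop then loses nothing to wrong predictions; any other slot is charged twice the
-- mean weight of a slot.
open Classical in
theorem le_gain_of_active (hδ1 : P.δ < 1) (hf : 0 ≤ P.reserve) (hT : 0 < P.T)
    (hB : 0 ≤ P.budget) {i : ℕ} (hi : i < P.T) (hact : ∃ e ∈ R, P.slot (u e) < i) :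
    ((1 - P.δ) / (1 + P.δ)) ^ 2 * (∑ ℓ ∈ R.image (P.levelOf I), P.density ℓ * P.relLoad I R w u ℓ i
      - ∑ ℓ ∈ R.image (P.levelOf I) with ¬ P.Steady I R w u ℓ,
        P.density ℓ * max (P.relLoad I R w u ℓ i - P.reserve) 0)
      - (if i ∈ P.dropSlots I H u then 2 * ((∑ e ∈ R, w e) / P.T) else 0)
      ≤ ∑ ℓ ∈ P.window (I.profile u) i, P.density ℓ * min (P.load (I.profile u) ℓ i)
        (P.alloc (I.profile u) i (P.center (I.profile u) i) ℓ + P.reserve) := by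
  have hL : R.image (P.levelOf I) ⊆ P.window (I.profile u) i := by
    intro ℓ hℓ
    obtain ⟨e, he, rfl⟩ := Finset.mem_image.1 hℓ
    exact hR.level_mem u i hact e he
  have hT' : (0 : ℝ) < P.T := by exact_mod_cast hT
  split_ifs with hd
  · have := le_gain_of_drop (W := P.window (I.profile u) i) (L := R.image (P.levelOf I))
      (τ := P.density) (s := fun ℓ => P.load (I.profile u) ℓ i)
      (a := P.alloc (I.profile u) i (P.center (I.profile u) i))
      (r := fun ℓ => P.relLoad I R w u ℓ i) (q := P.relMean I R w) (f := P.reserve)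
      (steady := P.Steady I R w u) hL hδ hδ1 hf (fun ℓ => (density_pos hδ ℓ).le)
      (fun ℓ => load_nonneg I u ℓ i) (P.alloc_nonneg _ _ _) (fun ℓ => hR.relLoad_le hδ u ℓ i)
      (hR.relMean_nonneg hδ) (fun ℓ _ h => (h i hi).2)
    rwa [sum_density_mul_relMean hδ] at this
  · rw [sub_zero]
    refine le_gain_of_no_drop (m := fun ℓ => P.low (I.profile u) ℓ i) (q := P.relMean I R w)
      (B := P.budget) hL hδ hδ1 hf (fun ℓ => (density_pos hδ ℓ).le)
      (fun ℓ => load_nonneg I u ℓ i) (P.alloc_nonneg _ _ _) (fun ℓ => greedy_le ℓ) ?_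
      (fun ℓ => hR.relLoad_nonneg hδ u ℓ i) (fun ℓ => hR.relLoad_le hδ u ℓ i)
      (hR.relMean_nonneg hδ) ?_ ?_ ?_
    · intro b hb0 hb hsum
      rw [window_eq] at hsum ⊢
      exact sum_mul_le_sum_mul_greedy hB (P.excess_nonneg _ i) (density_mono hδ)
        (fun ℓ => (density_pos hδ ℓ).le) hb0 hb _ hsum
    · intro ℓ _ hst
      refine ⟨(hst i hi).1, (hst i hi).2, ?_⟩
      -- The lower bound holds in every slot, so the running minimum inherits it.
      have hload : ∀ j < P.T, (1 - P.δ) / (1 + P.δ) * P.relMean I R w ℓ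
          ≤ P.load (I.profile u) ℓ j := by
        intro j hj
        rw [div_mul_eq_mul_div, div_le_iff₀ (by linarith), mul_comm (P.load _ _ _)]
        exact (hst j hj).1.trans (hR.relLoad_le hδ u ℓ j)
      exact le_running_min ((hload 0 hT).trans (load_le u ℓ 0)) (fun i => rfl) i
        fun j hj => hload j (hj.trans hi)
    · rw [← Finset.mul_sum]
      have h1 := hR.sum_relMean hδ
      have h2 := hR.size_le
      have h3 := mul_le_mul_of_nonneg_left h1 (by linarith : 0 ≤ 1 - P.δ)
      have h4 := mul_le_mul_of_nonneg_left h2 (by linarith : 0 ≤ 1 + P.δ)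
      rw [div_mul_eq_mul_div, div_le_iff₀ (by linarith)]
      refine le_of_mul_le_mul_left ?_ hT'
      linarith
    · intro ℓ hℓ
      by_contra! h
      refine hd (Finset.mem_biUnion.2 ⟨ℓ, hR.window_subset u i hact hℓ, ?_⟩)
      exact Finset.mem_filter.2 ⟨Finset.mem_range.2 hi, h⟩

open Classical in
/-- The value selected for a fixed outcome of the arrival times. -/
theorem le_value (hδ1 : P.δ < 1) (hf : 1 ≤ P.reserve) (hT : 0 < P.T)
    (hB : 0 ≤ P.budget) (hn : 1 ≤ n) :
    ∑ e ∈ tiny I, I.value e + ((1 - P.δ) / (1 + P.δ)) ^ 2 *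
        (∑ e ∈ R with ∃ e' ∈ R, P.slot (u e') < P.slot (u e), w e - P.unsteadyLoss I R w u)
      - H.card * (Real.log n / P.δ + 1) * (2 * ((∑ e ∈ R, w e) / P.T))
      ≤ ∑ e ∈ P.chosen I u, I.value e := by
  refine le_trans ?_ (le_value_chosen I u hδ hT)
  rw [add_sub_assoc]
  refine add_le_add le_rfl ?_
  set κ := ((1 - P.δ) / (1 + P.δ)) ^ 2 with hκ
  have hκ0 : 0 ≤ κ := by positivity
  set D := 2 * ((∑ e ∈ R, w e) / P.T) with hD
  have hD0 : 0 ≤ D := by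
    have : 0 ≤ ∑ e ∈ R, w e := Finset.sum_nonneg fun e _ => hR.weight_nonneg e
    positivity
  set gain : ℕ → ℝ := fun i => ∑ ℓ ∈ P.window (I.profile u) i, P.density ℓ *
    min (P.load (I.profile u) ℓ i)
      (P.alloc (I.profile u) i (P.center (I.profile u) i) ℓ + P.reserve) with hgain
  -- The other slots are given up, as their windows may be misplaced.
  set A := (Finset.range P.T).filter fun i => ∃ e ∈ R, P.slot (u e) < i with hA
  set loss : ℕ → ℝ := fun i => ∑ ℓ ∈ R.image (P.levelOf I) with ¬ P.Steady I R w u ℓ,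
    P.density ℓ * max (P.relLoad I R w u ℓ i - P.reserve) 0 with hloss
  have hloss0 : ∀ i, 0 ≤ loss i := fun i => Finset.sum_nonneg fun ℓ _ =>
    mul_nonneg (density_pos hδ ℓ).le (le_max_right _ _)
  have h1 : ∑ i ∈ A, gain i ≤ ∑ i ∈ Finset.range P.T, gain i := by
    refine Finset.sum_le_sum_of_subset_of_nonneg (Finset.filter_subset _ _) fun i _ _ => ?_
    exact Finset.sum_nonneg fun ℓ _ => mul_nonneg (density_pos hδ ℓ).le
      (le_min (load_nonneg I u ℓ i) (add_nonneg (P.alloc_nonneg _ _ _ _) (by linarith)))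
  refine le_trans ?_ h1
  have h2 : ∑ i ∈ A, (κ * ((∑ e ∈ R, if P.slot (u e) = i then w e else 0) - loss i)
      - if i ∈ P.dropSlots I H u then D else 0) ≤ ∑ i ∈ A, gain i := by
    refine Finset.sum_le_sum fun i hi => ?_
    obtain ⟨hi, hact⟩ := Finset.mem_filter.1 hi
    have := hR.le_gain_of_active hδ u hδ1 (by linarith) hT hB (Finset.mem_range.1 hi) hact
    rwa [sum_density_mul_relLoad hδ] at this
  refine le_trans ?_ h2
  rw [Finset.sum_sub_distrib, ← Finset.mul_sum, Finset.sum_sub_distrib]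
  have h3 : ∑ i ∈ A, ∑ e ∈ R, (if P.slot (u e) = i then w e else 0)
      = ∑ e ∈ R with ∃ e' ∈ R, P.slot (u e') < P.slot (u e), w e := by
    rw [Finset.sum_comm, Finset.sum_filter]
    refine Finset.sum_congr rfl fun e _ => ?_
    rw [Finset.sum_ite_eq]
    have : P.slot (u e) < P.T := P.slot_lt hT _
    simp [hA, this]
  have h4 : ∑ i ∈ A, loss i ≤ P.unsteadyLoss I R w u := by
    refine (Finset.sum_le_sum_of_subset_of_nonneg (Finset.filter_subset _ _)
      fun i _ _ => hloss0 i).trans (le_of_eq ?_)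
    simp only [hloss, unsteadyLoss]
    rw [Finset.sum_comm, Finset.sum_filter]
    refine Finset.sum_congr rfl fun ℓ _ => ?_
    by_cases h : P.Steady I R w u ℓ
    · simp [h]
    · simp [h, Finset.mul_sum]
  have h5 : ∑ i ∈ A, (if i ∈ P.dropSlots I H u then D else 0)
      ≤ H.card * (Real.log n / P.δ + 1) * D := by
    rw [← Finset.sum_filter, Finset.sum_const, nsmul_eq_mul]
    refine mul_le_mul_of_nonneg_right
      (le_trans ?_ (card_dropSlots_le (I := I) (H := H) hδ u hδ1 hf hn)) hD0
    exact Nat.cast_le.2 (Finset.card_le_card fun i hi => (Finset.mem_filter.1 hi).2)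
  rw [h3]
  have h6 := mul_le_mul_of_nonneg_left h4 hκ0
  rw [mul_sub, mul_sub]
  linarith

end Relevant

end Params

/-! ### Slots of uniform times: integrability, moments, first arrivals -/

namespace Params

variable {n : ℕ} {P : Params n}

theorem measurable_slot : Measurable P.slot := by
  have h : Measurable fun t : unitInterval => ⌈(t : ℝ) * P.T⌉₊ :=
    Nat.measurable_ceil.comp (measurable_subtype_coe.mul_const _)
  exact (measurable_of_countable (fun k : ℕ => k - 1)).comp h

theorem volume_le_slot (hT : 0 < P.T) {i : ℕ} (hi : i ≤ P.T) :
    volume.real {t | i ≤ P.slot t} = 1 - i / P.T := by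
  have hT' : (0 : ℝ) < P.T := by exact_mod_cast hT
  rcases Nat.eq_zero_or_pos i with rfl | hi0
  · simp
  · have hx : (i / P.T : ℝ) ∈ unitInterval :=
      ⟨by positivity, (div_le_one hT').2 (by exact_mod_cast hi)⟩
    -- Slot `i` is the interval `(i / T, (i + 1) / T]`; truncated subtraction puts time `0` into
    -- slot `0`.
    have : {t | i ≤ P.slot t} = Set.Ioi (⟨i / P.T, hx⟩ : unitInterval) := by
      ext t
      rw [Set.mem_ofPred_eq, Set.mem_Ioi, slot, ← Subtype.coe_lt_coe]
      simp only
      rw [div_lt_iff₀ hT', ← Nat.lt_ceil]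
      omega
    rw [this, measureReal_def, unitInterval.volume_Ioi, ENNReal.toReal_ofReal]
    linarith [hx.2]

theorem measurableSet_slot (s : Set ℕ) : MeasurableSet {t | P.slot t ∈ s} :=
  measurable_slot (MeasurableSet.of_discrete)

theorem volume_slot_eq (hT : 0 < P.T) {i : ℕ} (hi : i < P.T) :
    volume.real {t | P.slot t = i} = 1 / P.T := by
  have h : {t | P.slot t = i} = {t | i ≤ P.slot t} \ {t | i + 1 ≤ P.slot t} := by
    ext t; simp only [Set.mem_ofPred_eq, Set.mem_sdiff]; omega
  have hsub : {t | i + 1 ≤ P.slot t} ⊆ {t | i ≤ P.slot t} := fun t ht => by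
    simp only [Set.mem_ofPred_eq] at ht ⊢; omega
  have hm : MeasurableSet {t | i + 1 ≤ P.slot t} := measurableSet_slot (Set.Ici (i + 1))
  rw [h, measureReal_sdiff hsub hm, volume_le_slot hT hi.le, volume_le_slot hT hi]
  push_cast
  ring

/-- A function of the time slots alone is integrable. -/
theorem integrable_of_slots {G : (Fin n → unitInterval) → ℝ} (hT : 0 < P.T)
    (hG : ∀ u u', (∀ e, P.slot (u e) = P.slot (u' e)) → G u = G u') : Integrable G := by
  set S : (Fin n → unitInterval) → (Fin n → ℕ) := fun u e => P.slot (u e) with hS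
  have hSm : Measurable S :=
    measurable_pi_lambda _ fun e => measurable_slot.comp (measurable_pi_apply e)
  have hfac : Function.FactorsThrough G S := fun u u' h => hG u u' fun e => congrFun h e
  have hGF : G = Function.extend S G 0 ∘ S := by
    funext u; exact (hfac.extend_apply 0 u).symm
  have hm : Measurable G := by
    rw [hGF]; exact (measurable_of_countable _).comp hSm
  have hfin : (Set.range G).Finite := by
    have : (Set.range S).Finite := by
      refine (Set.Finite.pi' (t := fun _ : Fin n => Set.Iio P.T) fun _ => Set.finite_Iio _).subset ?_
      rintro _ ⟨u, rfl⟩ e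
      exact P.slot_lt hT _
    rw [hGF, Set.range_comp]
    exact this.image _
  obtain ⟨C, hC⟩ := (hfin.isBounded).exists_norm_le
  exact Integrable.of_bound hm.aestronglyMeasurable C
    (Filter.Eventually.of_forall fun u => hC _ ⟨u, rfl⟩)

theorem integral_slot_eq (hT : 0 < P.T) {i : ℕ} (hi : i < P.T) (c : ℝ) :
    ∫ t, (if P.slot t = i then c else 0) = c / P.T := by
  have : (fun t => if P.slot t = i then c else 0) = {t | P.slot t = i}.indicator fun _ => c := by
    funext t; simp [Set.indicator]
  have hm : MeasurableSet {t | P.slot t = i} := measurableSet_slot {i}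
  rw [this, integral_indicator_const _ hm, volume_slot_eq hT hi,
    smul_eq_mul]
  ring

section Moments

variable (A : Finset (Fin n)) (c : Fin n → ℝ) (i : ℕ)

theorem integral_sum_slot (hT : 0 < P.T) (hi : i < P.T) :
    ∫ u : Fin n → unitInterval, ∑ e ∈ A, (if P.slot (u e) = i then c e else 0)
      = (∑ e ∈ A, c e) / P.T := by
  rw [integral_finsetSum, Finset.sum_div]
  · refine Finset.sum_congr rfl fun e _ => ?_
    rw [← integral_slot_eq hT hi]
    exact integral_comp_eval (μ := fun _ : Fin n => (volume : Measure unitInterval)) (i := e)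
      (f := fun t => if P.slot t = i then c e else 0)
      ((Measurable.ite (measurableSet_slot {i}) measurable_const
        measurable_const).aestronglyMeasurable)
  · intro e _
    exact integrable_of_slots (P := P) hT fun u u' h => by rw [h e]

/-- The variance of the load of a slot is at most twice its expectation if the sizes are at most
two. -/
theorem integral_sub_mean_sq_le (hT : 0 < P.T) (hi : i < P.T) (hc0 : ∀ e ∈ A, 0 ≤ c e)
    (hc : ∀ e ∈ A, c e ≤ 2) :
    ∫ u : Fin n → unitInterval, ((∑ e ∈ A, if P.slot (u e) = i then c e else 0)
      - (∑ e ∈ A, c e) / P.T) ^ 2 ≤ 2 * ((∑ e ∈ A, c e) / P.T) := by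
  classical
  have hT' : (0 : ℝ) < P.T := by exact_mod_cast hT
  set X : Fin n → unitInterval → ℝ := fun e t =>
    if e ∈ A then (if P.slot t = i then c e else 0) else 0 with hX
  have hXm : ∀ e, Measurable (X e) := fun e => by
    by_cases h : e ∈ A
    · simp only [hX, h, if_true]
      exact Measurable.ite (measurableSet_slot {i}) measurable_const measurable_const
    · simp only [hX, h, if_false]; exact measurable_const
  have hXL : ∀ e, MemLp (X e) 2 volume := fun e => by
    refine MemLp.of_bound (hXm e).aestronglyMeasurable |c e| (Filter.Eventually.of_forall fun t => ?_)
    simp only [hX]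
    split_ifs <;> simp
  have hsum : ∀ u : Fin n → unitInterval,
      ∑ e ∈ A, (if P.slot (u e) = i then c e else 0) = ∑ e, X e (u e) := fun u => by
    simp only [hX]; rw [Finset.sum_ite_mem, Finset.univ_inter]
  have hvar := variance_sum_pi (μ := fun _ : Fin n => (volume : Measure unitInterval)) hXL
  have hmean : ∫ u : Fin n → unitInterval, ∑ e, X e (u e) = (∑ e ∈ A, c e) / P.T := by
    simp only [← hsum]; exact integral_sum_slot A c i hT hi
  have hfun : (∑ e, fun u : Fin n → unitInterval => X e (u e)) = fun u => ∑ e, X e (u e) := by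
    funext u; simp
  rw [hfun, variance_eq_integral] at hvar
  · rw [← volume_pi] at hvar
    rw [hmean] at hvar
    simp only [hsum]
    rw [hvar, Finset.sum_div, Finset.mul_sum, ← Finset.sum_subset (Finset.subset_univ A)]
    · refine Finset.sum_le_sum fun e he => ?_
      refine (variance_le_expectation_sq (hXm e).aestronglyMeasurable).trans ?_
      have : (X e ^ 2) = fun t => if P.slot t = i then c e ^ 2 else 0 := by
        funext t
        simp only [hX, he, if_true, Pi.pow_apply]
        split_ifs <;> simp
      rw [this, integral_slot_eq hT hi, ← mul_div_assoc]
      gcongr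
      nlinarith [hc0 e he, hc e he]
    · intro e _ he
      have : X e = fun _ => 0 := by funext t; simp [hX, he]
      rw [this]; exact variance_zero _
  · exact (Finset.measurable_sum _ fun e _ => (hXm e).comp (measurable_pi_apply e)).aemeasurable

end Moments

/-- A Riemann sum of `(1 - x) ^ s` exceeds `T` times the integral `1 / (s + 1)` by at most its
largest term. Bernoulli's inequality takes the place of the integral. -/
theorem sum_one_sub_div_pow_le (T s : ℕ) (hT : 0 < T) :
    ∑ i ∈ Finset.range T, (1 - (i : ℝ) / T) ^ s ≤ 1 + T / (s + 1) := by
  have hT' : (0 : ℝ) < T := by exact_mod_cast hT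
  have h1 : ∀ m : ℕ, ∑ k ∈ Finset.range m, ((k : ℝ) / T) ^ s
      ≤ T / (s + 1) * ((m : ℝ) / T) ^ (s + 1) := by
    intro m
    induction m with
    | zero => simp
    | succ m ih =>
      rw [Finset.sum_range_succ]
      refine (add_le_add ih le_rfl).trans ?_
      rcases Nat.eq_zero_or_pos m with rfl | hm
      · rcases Nat.eq_zero_or_pos s with rfl | hs
        · simp; field_simp; exact le_rfl
        · simp [hs.ne']; positivity
      have hm' : (0 : ℝ) < m := by exact_mod_cast hm
      have hb := one_add_mul_le_pow (a := 1 / (m : ℝ))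
        (by have : (0 : ℝ) < 1 / m := by positivity
            linarith) (s + 1)
      have h2 : ((m : ℝ) / T) ^ (s + 1) * (1 + ((s + 1 : ℕ) : ℝ) * (1 / m))
          ≤ (((m + 1 : ℕ) : ℝ) / T) ^ (s + 1) := by
        refine (mul_le_mul_of_nonneg_left hb (by positivity)).trans (le_of_eq ?_)
        rw [← mul_pow]; congr 1; push_cast; field_simp
      have h3 : T / (s + 1) * (((m : ℝ) / T) ^ (s + 1) * (1 + ((s + 1 : ℕ) : ℝ) * (1 / m)))
          = T / (s + 1) * ((m : ℝ) / T) ^ (s + 1) + ((m : ℝ) / T) ^ s := by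
        push_cast; rw [pow_succ]; field_simp
      rw [← h3]
      exact mul_le_mul_of_nonneg_left h2 (by positivity)
  have h2 : ∑ i ∈ Finset.range T, (1 - (i : ℝ) / T) ^ s
      = ∑ k ∈ Finset.range T, (((k + 1 : ℕ) : ℝ) / T) ^ s := by
    rw [← Finset.sum_range_reflect]
    refine Finset.sum_congr rfl fun i hi => ?_
    have hi' := Finset.mem_range.1 hi
    congr 1
    have : ((T - 1 - i : ℕ) : ℝ) = T - 1 - i := by
      rw [Nat.cast_sub (by omega), Nat.cast_sub (by omega)]; simp
    rw [this]; push_cast; field_simp; ring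
  have h3 := h1 T
  rw [div_self hT'.ne', one_pow, mul_one] at h3
  rw [h2]
  have h4 := Finset.sum_range_succ' (fun k : ℕ => ((k : ℝ) / T) ^ s) T
  have h5 := Finset.sum_range_succ (fun k : ℕ => ((k : ℝ) / T) ^ s) T
  rw [div_self hT'.ne', one_pow] at h5
  have h6 : 0 ≤ (((0 : ℕ) : ℝ) / T) ^ s := by positivity
  linarith

/-- The probability that no element of `R` arrives in a slot before that of `e`. -/
theorem volume_first_le (hT : 0 < P.T) {R : Finset (Fin n)} {e : Fin n} (he : e ∈ R) :
    volume.real {u : Fin n → unitInterval | ∀ e' ∈ R, P.slot (u e) ≤ P.slot (u e')}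
      ≤ 1 / P.T + 1 / R.card := by
  classical
  have hT' : (0 : ℝ) < P.T := by exact_mod_cast hT
  -- Once the slot `i` of `e` is fixed, the event becomes a box, whose volume is a product.
  set box : ℕ → Fin n → Set unitInterval := fun i e' =>
    if e' = e then {t | P.slot t = i} else if e' ∈ R then {t | i ≤ P.slot t} else Set.univ with hbox
  have hsub : {u : Fin n → unitInterval | ∀ e' ∈ R, P.slot (u e) ≤ P.slot (u e')}
      ⊆ ⋃ i ∈ Finset.range P.T, Set.univ.pi (box i) := by
    intro u hu
    refine Set.mem_biUnion (Finset.mem_range.2 (P.slot_lt hT (u e))) fun e' _ => ?_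
    simp only [hbox]
    split_ifs with h1 h2
    · simp [h1]
    · exact hu e' h2
    · trivial
  have hcard : ((R.erase e).card : ℝ) + 1 = R.card := by
    exact_mod_cast Finset.card_erase_add_one he
  have hvol : ∀ i ∈ Finset.range P.T, volume.real (Set.univ.pi (box i))
      = 1 / P.T * (1 - (i : ℝ) / P.T) ^ (R.erase e).card := by
    intro i hi
    have hi' := Finset.mem_range.1 hi
    rw [measureReal_def, volume_pi, Measure.pi_pi, ENNReal.toReal_prod,
      ← Finset.mul_prod_erase _ _ (Finset.mem_univ e)]
    congr 1
    · simp only [hbox, if_true]; exact volume_slot_eq hT hi'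
    · rw [← Finset.prod_subset (Finset.erase_subset_erase e (Finset.subset_univ R)),
        Finset.prod_congr rfl (g := fun _ => 1 - (i : ℝ) / P.T), Finset.prod_const]
      · intro e' he'
        obtain ⟨h1, h2⟩ := Finset.mem_erase.1 he'
        simp only [hbox, h1, h2, if_true, if_false]; exact volume_le_slot hT hi'.le
      · intro e' he' hne
        have h1 := (Finset.mem_erase.1 he').1
        have h2 : e' ∉ R := fun h => hne (Finset.mem_erase.2 ⟨h1, h⟩)
        simp [hbox, h1, h2]
  calc volume.real {u : Fin n → unitInterval | ∀ e' ∈ R, P.slot (u e) ≤ P.slot (u e')}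
      ≤ volume.real (⋃ i ∈ Finset.range P.T, Set.univ.pi (box i)) := measureReal_mono hsub (measure_ne_top _ _)
    _ ≤ ∑ i ∈ Finset.range P.T, volume.real (Set.univ.pi (box i)) :=
        measureReal_biUnion_finset_le _ _
    _ = 1 / P.T * ∑ i ∈ Finset.range P.T, (1 - (i : ℝ) / P.T) ^ (R.erase e).card := by
        rw [Finset.mul_sum]; exact Finset.sum_congr rfl hvol
    _ ≤ 1 / P.T * (1 + P.T / ((R.erase e).card + 1)) :=
        mul_le_mul_of_nonneg_left (sum_one_sub_div_pow_le _ _ hT) (by positivity)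
    _ = _ := by rw [hcard, mul_add, mul_one, ← mul_div_assoc, one_div_mul_cancel hT'.ne']

end Params

/-! ### The expected value of the acceptance rule -/

namespace Params

namespace Relevant

variable {n : ℕ} {P : Params n} {I : Instance n} {R : Finset (Fin n)} {w : Fin n → ℝ} {H : Finset ℤ}
variable (hR : P.Relevant I R w H) (hδ : 0 < P.δ) (hT : 0 < P.T)
include hδ hT

omit hδ in
theorem sum_relLoad (u : Fin n → unitInterval) (ℓ : ℤ) :
    ∑ i ∈ Finset.range P.T, P.relLoad I R w u ℓ i = P.T * P.relMean I R w ℓ := by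
  have hT' : (P.T : ℝ) ≠ 0 := by positivity
  simp only [relLoad]
  rw [Finset.sum_comm, relMean, mul_div_cancel₀ _ hT']
  refine Finset.sum_congr rfl fun e _ => ?_
  rw [Finset.sum_ite_eq, if_pos (Finset.mem_range.2 (P.slot_lt hT _))]

omit hδ hT in
theorem relLoad_congr {u u' : Fin n → unitInterval} (h : ∀ e, P.slot (u e) = P.slot (u' e))
    (ℓ : ℤ) (i : ℕ) : P.relLoad I R w u ℓ i = P.relLoad I R w u' ℓ i := by
  simp only [relLoad, h]

omit hδ in
theorem integrable_sq (ℓ : ℤ) (i : ℕ) :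
    Integrable fun u : Fin n → unitInterval => (P.relLoad I R w u ℓ i - P.relMean I R w ℓ) ^ 2 :=
  integrable_of_slots hT fun u u' h => by rw [relLoad_congr h]

omit hδ in
theorem integrable_unsteadyLoss : Integrable (P.unsteadyLoss I R w) :=
  integrable_of_slots hT fun u u' h => by
    have h1 : P.relLoad I R w u = P.relLoad I R w u' := by
      funext ℓ i; exact relLoad_congr h ℓ i
    have h2 : P.Steady I R w u = P.Steady I R w u' := by
      funext ℓ; simp only [Steady, h1]
    simp only [unsteadyLoss, h1]
    refine Finset.sum_congr rfl fun ℓ _ => ?_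
    by_cases h3 : P.Steady I R w u' ℓ
    · rw [if_pos h3, if_pos (h2 ▸ h3)]
    · rw [if_neg h3, if_neg (h2 ▸ h3)]

include hR

theorem integral_sq_le (ℓ : ℤ) {i : ℕ} (hi : i < P.T) (hδ1 : P.δ < 1) :
    ∫ u : Fin n → unitInterval, (P.relLoad I R w u ℓ i - P.relMean I R w ℓ) ^ 2
      ≤ 2 * P.relMean I R w ℓ := by
  refine integral_sub_mean_sq_le (R.filter fun e => P.levelOf I e = ℓ) (P.effSize I w) i hT hi
    (fun e _ => hR.effSize_nonneg hδ e) fun e he => ?_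
  have := hR.effSize_le hδ (Finset.mem_filter.1 he).1
  nlinarith [I.size_le_one e, I.size_nonneg e]

open Classical in
/-- The loss of a level that is not spread evenly is at most a weighted sum of squared deviations. -/
theorem indicator_mul_sum_le {β : ℝ} (hβ : 0 < β)
    (hf : 2 * β ≤ P.reserve) (ℓ : ℤ) (u : Fin n → unitInterval) :
    (if P.Steady I R w u ℓ then 0 else 1) *
      ∑ i ∈ Finset.range P.T, max (P.relLoad I R w u ℓ i - P.reserve) 0
      ≤ max (1 / β) (P.T / (P.δ ^ 2 * β)) *
        ∑ i ∈ Finset.range P.T, (P.relLoad I R w u ℓ i - P.relMean I R w ℓ) ^ 2 := by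
  set q := P.relMean I R w ℓ with hq
  set r := P.relLoad I R w u ℓ with hr
  set M := max (1 / β) (P.T / (P.δ ^ 2 * β)) with hM
  have hq0 : 0 ≤ q := hR.relMean_nonneg hδ ℓ
  have hM0 : 0 ≤ M := le_max_of_le_left (by positivity)
  have hsq0 : 0 ≤ ∑ i ∈ Finset.range P.T, (r i - q) ^ 2 := Finset.sum_nonneg fun i _ => sq_nonneg _
  split_ifs with hst
  · rw [zero_mul]; positivity
  rw [one_mul]
  -- For `q ≤ β ≤ reserve / 2`, a positive overflow is at most `r i - q`, which is then at least
  -- `β`. For `q ≥ β`, the overflows sum to at most `T * q`, while some slot deviates from the mean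
  -- by at least `δ * q`.
  rcases le_total q β with hqβ | hqβ
  · rw [Finset.mul_sum]
    refine Finset.sum_le_sum fun i _ => ?_
    refine le_trans ?_ (mul_le_mul_of_nonneg_right (le_max_left (1 / β) _) (sq_nonneg (r i - q)))
    refine max_le ?_ (by positivity)
    rw [one_div_mul_eq_div, le_div_iff₀ hβ]
    rcases le_total (r i) P.reserve with h | h
    · nlinarith [sq_nonneg (r i - q)]
    · nlinarith
  · have hqpos : 0 < q := hβ.trans_le hqβ
    have h1 : ∑ i ∈ Finset.range P.T, max (r i - P.reserve) 0 ≤ P.T * q := by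
      rw [hq, ← sum_relLoad hT u ℓ]
      refine Finset.sum_le_sum fun i _ => max_le ?_ (hR.relLoad_nonneg hδ u ℓ i)
      have : 0 ≤ P.reserve := by linarith
      simp only [hr]; linarith
    refine h1.trans ?_
    have h2 : (P.δ * q) ^ 2 ≤ ∑ i ∈ Finset.range P.T, (r i - q) ^ 2 := by
      simp only [Steady, not_forall] at hst
      obtain ⟨i, hi, h⟩ := hst
      refine le_trans ?_ (Finset.single_le_sum (f := fun i => (r i - q) ^ 2)
        (fun i _ => sq_nonneg _) (Finset.mem_range.2 hi))
      have hδq : 0 < P.δ * q := by positivity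
      rw [sq_le_sq, abs_of_pos hδq]
      by_contra! hlt
      obtain ⟨h3, h4⟩ := abs_lt.1 hlt
      exact h ⟨by linarith, by linarith⟩
    refine le_trans ?_ (mul_le_mul (le_max_right (1 / β) _) h2 (by positivity) hM0)
    rw [div_mul_eq_mul_div, le_div_iff₀ (by positivity)]
    have hT' : (0 : ℝ) < P.T := by exact_mod_cast hT
    calc P.T * q * (P.δ ^ 2 * β) ≤ P.T * q * (P.δ ^ 2 * q) := by gcongr
      _ = _ := by ring

/-- An argument in the style of Chebyshev: squared deviations dominate the loss, and their
expectations are linear in `relMean`, hence sum to a multiple of the weight of `R`. The condition on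
`β` makes the factor at most `δ`. -/
theorem integral_unsteadyLoss_le (hδ1 : P.δ < 1) {β : ℝ} (hβ : 0 < β) (hf : 2 * β ≤ P.reserve)
    (hβT : 2 * P.T ≤ P.δ ^ 3 * β) :
    ∫ u, P.unsteadyLoss I R w u ≤ P.δ * ∑ e ∈ R, w e := by
  have hT' : (1 : ℝ) ≤ P.T := by exact_mod_cast hT
  set M := max (1 / β) (P.T / (P.δ ^ 2 * β)) with hM
  have hM0 : 0 ≤ M := le_max_of_le_left (by positivity)
  have hM2 : 2 * M ≤ P.δ := by
    have hδ3 : P.δ ^ 3 ≤ P.δ := by nlinarith [sq_nonneg P.δ, pow_pos hδ 2]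
    have : M ≤ P.δ / 2 := by
      refine max_le ?_ ?_
      · rw [div_le_div_iff₀ hβ two_pos]
        have := mul_le_mul_of_nonneg_right hδ3 hβ.le
        linarith
      · rw [div_le_div_iff₀ (by positivity) two_pos]
        calc P.T * 2 ≤ P.δ ^ 3 * β := by linarith
          _ = _ := by ring
    linarith
  have hpt : ∀ u, P.unsteadyLoss I R w u ≤ ∑ ℓ ∈ R.image (P.levelOf I), P.density ℓ * (M *
      ∑ i ∈ Finset.range P.T, (P.relLoad I R w u ℓ i - P.relMean I R w ℓ) ^ 2) := fun u =>
    Finset.sum_le_sum fun ℓ _ => mul_le_mul_of_nonneg_left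
      (hR.indicator_mul_sum_le hδ hT hβ hf ℓ u) (density_pos hδ ℓ).le
  have hint : ∀ ℓ, Integrable fun u : Fin n → unitInterval => P.density ℓ * (M *
      ∑ i ∈ Finset.range P.T, (P.relLoad I R w u ℓ i - P.relMean I R w ℓ) ^ 2) := fun ℓ =>
    ((integrable_finsetSum _ fun i _ => integrable_sq hT ℓ i).const_mul _).const_mul _
  refine (integral_mono (integrable_unsteadyLoss hT)
    (integrable_finsetSum _ fun ℓ _ => hint ℓ) hpt).trans ?_
  rw [integral_finsetSum _ fun ℓ _ => hint ℓ]
  calc ∑ ℓ ∈ R.image (P.levelOf I), ∫ u : Fin n → unitInterval, P.density ℓ * (M *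
      ∑ i ∈ Finset.range P.T, (P.relLoad I R w u ℓ i - P.relMean I R w ℓ) ^ 2)
      ≤ ∑ ℓ ∈ R.image (P.levelOf I), P.density ℓ * (M * (P.T * (2 * P.relMean I R w ℓ))) := by
        refine Finset.sum_le_sum fun ℓ _ => ?_
        rw [integral_const_mul, integral_const_mul,
          integral_finsetSum _ fun i _ => integrable_sq hT ℓ i]
        refine mul_le_mul_of_nonneg_left (mul_le_mul_of_nonneg_left ?_ hM0) (density_pos hδ ℓ).le
        refine (Finset.sum_le_sum fun i hi =>
          hR.integral_sq_le hδ hT ℓ (Finset.mem_range.1 hi) hδ1).trans (le_of_eq ?_)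
        rw [Finset.sum_const, Finset.card_range, nsmul_eq_mul]
    _ = 2 * M * (P.T * ∑ ℓ ∈ R.image (P.levelOf I), P.density ℓ * P.relMean I R w ℓ) := by
        rw [Finset.mul_sum, Finset.mul_sum]
        exact Finset.sum_congr rfl fun ℓ _ => by ring
    _ = 2 * M * ∑ e ∈ R, w e := by
        rw [sum_density_mul_relMean hδ, mul_div_cancel₀ _ (by positivity)]
    _ ≤ _ := mul_le_mul_of_nonneg_right hM2 (Finset.sum_nonneg fun e _ => hR.weight_nonneg e)

omit hδ

open Classical in
/-- The expected weight of the elements that do not arrive in the first slot with an element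
of `R`. -/
theorem le_integral_active (hne : R.Nonempty) {μ : ℝ} (hμ : ∀ e ∈ R, w e ≤ μ) :
    (1 - 1 / P.T) * ∑ e ∈ R, w e - μ ≤ ∫ u : Fin n → unitInterval,
      ∑ e ∈ R with ∃ e' ∈ R, P.slot (u e') < P.slot (u e), w e := by
  have hcard : (0 : ℝ) < R.card := by exact_mod_cast hne.card_pos
  have hmeas : ∀ e, MeasurableSet {u : Fin n → unitInterval |
      ∀ e' ∈ R, P.slot (u e) ≤ P.slot (u e')} := fun e => by
    have : {u : Fin n → unitInterval | ∀ e' ∈ R, P.slot (u e) ≤ P.slot (u e')}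
        = ⋂ e' ∈ R, {u | P.slot (u e) ≤ P.slot (u e')} := by ext u; simp
    rw [this]
    exact Finset.measurableSet_biInter _ fun e' _ => measurableSet_le
      (measurable_slot.comp (measurable_pi_apply e)) (measurable_slot.comp (measurable_pi_apply e'))
  have hfun : (fun u : Fin n → unitInterval =>
      ∑ e ∈ R with ∃ e' ∈ R, P.slot (u e') < P.slot (u e), w e)
      = fun u => ∑ e ∈ R, (w e - Set.indicator {u : Fin n → unitInterval |
        ∀ e' ∈ R, P.slot (u e) ≤ P.slot (u e')} (fun _ => w e) u) := by
    funext u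
    rw [Finset.sum_filter]
    refine Finset.sum_congr rfl fun e _ => ?_
    by_cases h : ∃ e' ∈ R, P.slot (u e') < P.slot (u e)
    · rw [if_pos h, Set.indicator_of_notMem, sub_zero]
      simpa using h
    · rw [if_neg h, Set.indicator_of_mem, sub_self]
      simpa using h
  rw [hfun, integral_finsetSum]
  · have h1 : ∀ e ∈ R, w e - (1 / P.T + 1 / R.card) * w e
        ≤ ∫ u : Fin n → unitInterval, (w e - Set.indicator {u : Fin n → unitInterval |
          ∀ e' ∈ R, P.slot (u e) ≤ P.slot (u e')} (fun _ => w e) u) := by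
      intro e he
      rw [integral_sub (integrable_const _) ((integrable_const _).indicator (hmeas e)),
        integral_indicator_const _ (hmeas e), integral_const, probReal_univ, one_smul, smul_eq_mul]
      have := mul_le_mul_of_nonneg_right (volume_first_le hT he) (hR.weight_nonneg e)
      linarith
    refine le_trans ?_ (Finset.sum_le_sum h1)
    rw [Finset.sum_sub_distrib, ← Finset.mul_sum]
    -- Summed over `R`, the term `1 / R.card` costs at most one maximal weight.
    have h2 : ∑ e ∈ R, w e ≤ R.card * μ := by
      rw [← nsmul_eq_mul]; exact Finset.sum_le_card_nsmul _ _ _ hμ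
    have h3 : 1 / (R.card : ℝ) * ∑ e ∈ R, w e ≤ μ := by
      rw [one_div_mul_eq_div, div_le_iff₀ hcard]; linarith
    linarith
  · intro e _
    exact (integrable_const _).sub ((integrable_const _).indicator (hmeas e))

include hδ

/-- The expected value selected by the acceptance rule. -/
theorem le_integral_value (hδ1 : P.δ < 1) (hB : 0 ≤ P.budget) (hn : 1 ≤ n) {β : ℝ} (hβ : 1 ≤ β)
    (hf : 2 * β ≤ P.reserve) (hβT : 2 * P.T ≤ P.δ ^ 3 * β)
    (hTδ : 1 ≤ P.δ * P.T) (hH : 2 * (H.card * (Real.log n / P.δ + 1)) ≤ P.δ * P.T)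
    (hint : Integrable fun u => ∑ e ∈ P.chosen I u, I.value e) (hne : R.Nonempty)
    {μ : ℝ} (hμ : ∀ e ∈ R, w e ≤ μ) :
    ∑ e ∈ tiny I, I.value e + (1 - 7 * P.δ) * ∑ e ∈ R, w e - μ
      ≤ ∫ u, ∑ e ∈ P.chosen I u, I.value e := by
  classical
  have hT' : (0 : ℝ) < P.T := by exact_mod_cast hT
  set κ := ((1 - P.δ) / (1 + P.δ)) ^ 2 with hκ
  set S := ∑ e ∈ R, w e with hS
  have hS0 : 0 ≤ S := Finset.sum_nonneg fun e _ => hR.weight_nonneg e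
  have hμ0 : 0 ≤ μ := by
    obtain ⟨e, he⟩ := hne
    exact (hR.weight_nonneg e).trans (hμ e he)
  have hκ1 : κ ≤ 1 := by
    rw [hκ]
    refine pow_le_one₀ (div_nonneg (by linarith) (by linarith)) ?_
    rw [div_le_one (by linarith)]; linarith
  -- Of the final loss `7 * δ`, `4 * δ` comes from `κ`, and `δ` each from `1 / T`, the unsteady
  -- levels and the drops.
  have hκ2 : 1 - 4 * P.δ ≤ κ := by
    rw [hκ, div_pow, le_div_iff₀ (by positivity)]
    nlinarith [pow_pos hδ 2, pow_pos hδ 3]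
  have hκ0 : 0 ≤ κ := by rw [hκ]; positivity
  have hact : Integrable fun u : Fin n → unitInterval =>
      ∑ e ∈ R with ∃ e' ∈ R, P.slot (u e') < P.slot (u e), w e :=
    integrable_of_slots hT fun u u' h => by simp only [h]
  have hloss := integrable_unsteadyLoss (P := P) (I := I) (R := R) (w := w) hT
  set D := H.card * (Real.log n / P.δ + 1) * (2 * (S / P.T)) with hD
  have hDle : D ≤ P.δ * S := by
    have : D = 2 * (H.card * (Real.log n / P.δ + 1)) * (S / P.T) := by rw [hD]; ring
    rw [this]
    calc 2 * (H.card * (Real.log n / P.δ + 1)) * (S / P.T) ≤ P.δ * P.T * (S / P.T) := by gcongr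
      _ = P.δ * S := by field_simp
  have hdiff : Integrable fun u : Fin n → unitInterval =>
      κ * (∑ e ∈ R with ∃ e' ∈ R, P.slot (u e') < P.slot (u e), w e - P.unsteadyLoss I R w u) :=
    (hact.sub hloss).const_mul κ
  have hsum : Integrable fun u : Fin n → unitInterval => ∑ e ∈ tiny I, I.value e +
      κ * (∑ e ∈ R with ∃ e' ∈ R, P.slot (u e') < P.slot (u e), w e - P.unsteadyLoss I R w u) :=
    (integrable_const _).add hdiff
  have h1 := integral_mono (hsum.sub (integrable_const D)) hint
    (fun u => hR.le_value hδ u hδ1 (by linarith) hT hB hn)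
  refine le_trans ?_ h1
  rw [integral_sub' hsum (integrable_const D), integral_add (integrable_const _) hdiff,
    integral_const_mul, integral_sub hact hloss, integral_const, integral_const,
    probReal_univ, one_smul, one_smul]
  have h2 := hR.le_integral_active hT hne hμ
  have h3 := hR.integral_unsteadyLoss_le hδ hT hδ1 (by linarith) hf hβT
  have h4 : 1 / P.T * S ≤ P.δ * S := by
    refine mul_le_mul_of_nonneg_right ?_ hS0
    rwa [div_le_iff₀ hT']
  have h5 : (1 - 2 * P.δ) * S - μ ≤ (∫ u : Fin n → unitInterval,
      ∑ e ∈ R with ∃ e' ∈ R, P.slot (u e') < P.slot (u e), w e)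
      - ∫ u, P.unsteadyLoss I R w u := by linarith
  have h6 := mul_le_mul_of_nonneg_left h5 hκ0
  have h7 : (1 - 6 * P.δ) * S - μ ≤ κ * ((1 - 2 * P.δ) * S - μ) := by
    have h8 : κ * μ ≤ μ := by nlinarith
    have h9 : (1 - 4 * P.δ) * S ≤ κ * S := mul_le_mul_of_nonneg_right hκ2 hS0
    have h10 : κ * S ≤ S := by nlinarith
    nlinarith
  linarith

end Relevant

end Params

/-! ### Measurability of orders, selections and the acceptance rule -/

variable {n : ℕ}

namespace Instance

variable (I : Instance n)

theorem measurable_arrivalTime (e : Fin n) :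
    Measurable fun u : Fin n → unitInterval => I.arrivalTime u e := by
  unfold arrivalTime
  split_ifs
  · exact measurable_pi_apply e
  · exact measurable_const

/-- `Tuple.sort` breaks ties by index, so a given order amounts to finitely many comparisons of
arrival times. -/
theorem measurableSet_order_eq (σ : Equiv.Perm (Fin n)) :
    MeasurableSet {u : Fin n → unitInterval | I.order u = σ} := by
  have h : {u : Fin n → unitInterval | I.order u = σ}
      = (⋂ i, ⋂ j, ⋂ (_ : i ≤ j), {u | I.arrivalTime u (σ i) ≤ I.arrivalTime u (σ j)}) ∩
        ⋂ i, ⋂ j, ⋂ (_ : i < j), ⋂ (_ : ¬ σ i < σ j),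
          {u | I.arrivalTime u (σ i) = I.arrivalTime u (σ j)}ᶜ := by
    ext u
    rw [Set.mem_ofPred_eq, order, eq_comm, Tuple.eq_sort_iff]
    simp only [Set.mem_inter_iff, Set.mem_iInter, Set.mem_compl_iff, Set.mem_ofPred_eq]
    refine and_congr Iff.rfl ?_
    exact forall_congr' fun i => forall_congr' fun j => forall_congr' fun _ => not_imp_not.symm
  rw [h]
  refine MeasurableSet.inter ?_ ?_
  · exact MeasurableSet.iInter fun i => MeasurableSet.iInter fun j => MeasurableSet.iInter fun _ =>
      measurableSet_le (I.measurable_arrivalTime _) (I.measurable_arrivalTime _)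
  · exact MeasurableSet.iInter fun i => MeasurableSet.iInter fun j => MeasurableSet.iInter fun _ =>
      MeasurableSet.iInter fun _ => (measurableSet_eq_fun (I.measurable_arrivalTime _)
        (I.measurable_arrivalTime _)).compl

theorem measurable_profile (e : Fin n) :
    Measurable fun u : Fin n → unitInterval => I.profile u e :=
  (I.measurable_arrivalTime e).prodMk measurable_const

end Instance

namespace OnlineAlgorithm

variable (A : OnlineAlgorithm) (I : Instance n)

theorem mem_selected {ω : A.Seed} {u : Fin n → unitInterval} {e : Fin n} :
    e ∈ A.selected I ω u ↔
      A.accept ((I.order u).symm e) ω (I.history u ((I.order u).symm e)) = true := by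
  simp only [selected, Finset.mem_map_equiv, Finset.mem_filter, Finset.mem_univ, true_and]
  rfl

/-- For a fixed order the history is a measurable function of the times, and there are finitely many
orders. -/
theorem measurableSet_mem_selected (e : Fin n) :
    MeasurableSet {p : A.Seed × (Fin n → unitInterval) | e ∈ A.selected I p.1 p.2} := by
  have h : {p : A.Seed × (Fin n → unitInterval) | e ∈ A.selected I p.1 p.2}
      = ⋃ σ : Equiv.Perm (Fin n), {p | I.order p.2 = σ} ∩
        {p | A.accept (σ.symm e) p.1 (fun j : Fin (σ.symm e + 1) => I.profile p.2
          (σ (Fin.castLE (Nat.succ_le_of_lt (σ.symm e).isLt) j))) = true} := by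
    ext p
    simp only [Set.mem_ofPred_eq, Set.mem_iUnion, Set.mem_inter_iff, mem_selected]
    exact ⟨fun h => ⟨_, rfl, h⟩, by rintro ⟨σ, rfl, h⟩; exact h⟩
  rw [h]
  refine MeasurableSet.iUnion fun σ => MeasurableSet.inter ?_ ?_
  · exact measurable_snd (I.measurableSet_order_eq σ)
  · have hm : Measurable fun p : A.Seed × (Fin n → unitInterval) =>
        A.accept (σ.symm e) p.1 (fun j : Fin (σ.symm e + 1) => I.profile p.2
          (σ (Fin.castLE (Nat.succ_le_of_lt (σ.symm e).isLt) j))) :=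
      (A.measurable_accept _).comp (measurable_fst.prodMk (measurable_pi_lambda _ fun j =>
        (I.measurable_profile _).comp measurable_snd))
    exact hm (measurableSet_singleton true)

theorem measurable_value : Measurable fun p : A.Seed × (Fin n → unitInterval) =>
    ∑ e ∈ A.selected I p.1 p.2, I.value e := by
  classical
  have : (fun p : A.Seed × (Fin n → unitInterval) => ∑ e ∈ A.selected I p.1 p.2, I.value e)
      = fun p => ∑ e, if e ∈ A.selected I p.1 p.2 then I.value e else 0 := by
    funext p; rw [Finset.sum_ite_mem, Finset.univ_inter]
  rw [this]
  exact Finset.measurable_sum _ fun e _ =>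
    Measurable.ite (A.measurableSet_mem_selected I e) measurable_const measurable_const

theorem norm_value_le (ω : A.Seed) (u : Fin n → unitInterval) :
    ‖∑ e ∈ A.selected I ω u, I.value e‖ ≤ ∑ e, I.value e := by
  rw [Real.norm_of_nonneg (Finset.sum_nonneg fun e _ => I.value_nonneg e)]
  exact Finset.sum_le_sum_of_subset_of_nonneg (Finset.subset_univ _) fun e _ _ => I.value_nonneg e

theorem integrable_value : Integrable (fun p : A.Seed × (Fin n → unitInterval) =>
    ∑ e ∈ A.selected I p.1 p.2, I.value e) (A.law.prod volume) :=
  Integrable.of_bound (A.measurable_value I).aestronglyMeasurable _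
    (Filter.Eventually.of_forall fun p => A.norm_value_le I p.1 p.2)

theorem integrable_value_seed (ω : A.Seed) : Integrable fun u : Fin n → unitInterval =>
    ∑ e ∈ A.selected I ω u, I.value e :=
  Integrable.of_bound ((A.measurable_value I).comp measurable_prodMk_left).aestronglyMeasurable _
    (Filter.Eventually.of_forall fun u => A.norm_value_le I ω u)

theorem expectedValue_nonneg : 0 ≤ A.expectedValue I :=
  integral_nonneg fun _ => Finset.sum_nonneg fun e _ => I.value_nonneg e

end OnlineAlgorithm

namespace Params

variable (P : Params n)

theorem measurable_level : Measurable P.level := by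
  have : Measurable fun a : Arrival => Real.logb (1 + P.δ) (a.2.2 / a.2.1) :=
    (Real.measurable_log.comp (by fun_prop)).div_const _
  exact Int.measurable_floor.comp this

theorem measurableSet_eligible : MeasurableSet {a : Arrival | Eligible n a} := by
  have h1 : MeasurableSet {a : Arrival | 1 < (n : ℝ) * a.2.1} :=
    measurableSet_lt measurable_const (by fun_prop)
  have h2 : MeasurableSet {a : Arrival | 0 < a.2.2} :=
    measurableSet_lt measurable_const (by fun_prop)
  exact h1.inter h2

theorem measurableSet_inClass (ℓ : ℤ) (i : ℕ) : MeasurableSet {a : Arrival | P.InClass ℓ i a} :=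
  measurableSet_eligible.inter ((P.measurable_level (measurableSet_singleton ℓ)).inter
    ((measurable_slot.comp measurable_fst) (measurableSet_singleton i)))

section History

variable {ι : Type*} [Fintype ι]

theorem measurable_load (ℓ : ℤ) (i : ℕ) : Measurable fun h : ι → Arrival => P.load h ℓ i := by
  classical
  unfold load
  refine Finset.measurable_sum _ fun j _ => Measurable.ite ?_ (by fun_prop) measurable_const
  have hj : Measurable fun h : ι → Arrival => h j := measurable_pi_apply j
  exact hj (P.measurableSet_inClass ℓ i)

theorem measurable_center (i : ℕ) : Measurable fun h : ι → Arrival => P.center h i := by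
  have h1 : Measurable fun h : ι → Arrival => P.worth h i := by
    unfold worth
    refine Finset.measurable_sum _ fun j _ => Measurable.ite ?_ (by fun_prop) measurable_const
    have : Measurable fun h : ι → Arrival => P.slot (h j).1 := measurable_slot.comp (by fun_prop)
    exact this (measurableSet_Iio (a := i))
  exact Int.measurable_floor.comp ((Real.measurable_log.comp h1).div_const _)

theorem measurable_excess (i : ℕ) (ℓ : ℤ) :
    Measurable fun h : ι → Arrival => P.excess h i ℓ := by
  have h1 : Measurable fun h : ι → Arrival => P.low h ℓ i := by
    induction i with
    | zero => exact measurable_const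
    | succ i ih => exact ih.min (P.measurable_load ℓ i)
  exact (h1.sub_const _).max measurable_const

theorem measurable_alloc (i : ℕ) (c ℓ : ℤ) :
    Measurable fun h : ι → Arrival => P.alloc h i c ℓ :=
  (P.measurable_excess i ℓ).min (((measurable_const.sub
    (Finset.measurable_sum _ fun k _ => P.measurable_excess i k))).max measurable_const)

theorem measurableSet_accepts (j : ι) :
    MeasurableSet {h : ι → Arrival | P.Accepts h (h j)} := by
  -- Slot, centre and level take countably many values, so they can be fixed; the remaining
  -- inequality is measurable.
  have heq : {h : ι → Arrival | P.Accepts h (h j)} =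
      {h | (n : ℝ) * (h j).2.1 ≤ 1} ∪
      ({h | Eligible n (h j)} ∩ ⋃ x : ℕ × ℤ × ℤ, {h | P.slot (h j).1 = x.1} ∩
        ({h | P.center h x.1 = x.2.1} ∩ ({h | P.level (h j) = x.2.2} ∩
          ({_h | x.2.2 ∈ Finset.Icc (x.2.1 - P.radius) (x.2.1 + P.radius)} ∩
            {h | P.load h x.2.2 x.1 ≤ P.alloc h x.1 x.2.1 x.2.2 + P.reserve + 1})))) := by
    ext h
    simp only [Accepts, window, Set.mem_union, Set.mem_inter_iff, Set.mem_iUnion, Set.mem_ofPred_eq]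
    refine or_congr Iff.rfl (and_congr Iff.rfl ⟨fun h' =>
      ⟨(P.slot (h j).1, P.center h (P.slot (h j).1), P.level (h j)), rfl, rfl, rfl, h'⟩, ?_⟩)
    rintro ⟨⟨i, c, ℓ⟩, h1, h2, h3, h4⟩
    simp only at h1 h2 h3 h4
    subst h1 h2 h3
    exact h4
  have hj : Measurable fun h : ι → Arrival => h j := measurable_pi_apply j
  have hslot : Measurable fun h : ι → Arrival => P.slot (h j).1 := measurable_slot.comp (by fun_prop)
  have hlevel : Measurable fun h : ι → Arrival => P.level (h j) :=
    P.measurable_level.comp hj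
  rw [heq]
  refine (measurableSet_le (by fun_prop) measurable_const).union
    ((hj measurableSet_eligible).inter (MeasurableSet.iUnion fun x => ?_))
  exact (hslot (measurableSet_singleton x.1)).inter
    ((P.measurable_center x.1 (measurableSet_singleton x.2.1)).inter
      ((hlevel (measurableSet_singleton x.2.2)).inter ((MeasurableSet.const _).inter
        (measurableSet_le (P.measurable_load _ _)
          (((P.measurable_alloc _ _ _).add_const _).add_const _)))))

end History

/-- The distribution of the seed: `0` with probability `1 - δ`, otherwise uniform. -/
noncomputable def seedLaw (hn : 0 < n) (hδ : 0 ≤ P.δ) (hδ1 : P.δ ≤ 1) : PMF (Fin (n + 1)) :=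
  PMF.ofFintype (Fin.cons (ENNReal.ofReal (1 - P.δ)) fun _ => ENNReal.ofReal (P.δ / n)) (by
    have hn' : (0 : ℝ) < n := by exact_mod_cast hn
    rw [Fin.sum_univ_succ]
    simp only [Fin.cons_zero, Fin.cons_succ, Finset.sum_const, Finset.card_univ, Fintype.card_fin,
      nsmul_eq_mul]
    rw [← ENNReal.ofReal_natCast n, ← ENNReal.ofReal_mul (by positivity),
      ← ENNReal.ofReal_add (by linarith) (by positivity), mul_div_cancel₀ _ hn'.ne']
    simp)

open Classical in
/-- With probability `1 - δ` the acceptance rule is applied; otherwise a single item in a uniformly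
random position is selected. -/
noncomputable abbrev algorithm (hn : 0 < n) (hδ : 0 ≤ P.δ) (hδ1 : P.δ ≤ 1) : OnlineAlgorithm where
  Seed := Fin (n + 1)
  law := (P.seedLaw hn hδ hδ1).toMeasure
  accept k ω h := decide ((ω = 0 ∧ P.Accepts h (h (Fin.last k))) ∨ (ω : ℕ) = k + 1)
  measurable_accept k := by
    refine measurable_to_bool ?_
    have : (fun p : Fin (n + 1) × (Fin (k + 1) → Arrival) =>
        decide ((p.1 = 0 ∧ P.Accepts p.2 (p.2 (Fin.last k))) ∨ (p.1 : ℕ) = k + 1)) ⁻¹' {true}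
        = (Prod.fst ⁻¹' {0} ∩ Prod.snd ⁻¹' {h | P.Accepts h (h (Fin.last k))}) ∪
          Prod.fst ⁻¹' {ω : Fin (n + 1) | (ω : ℕ) = k + 1} := by
      ext p; simp
    rw [this]
    exact ((measurable_fst (MeasurableSet.of_discrete)).inter
      (measurable_snd (P.measurableSet_accepts _))).union
        (measurable_fst (MeasurableSet.of_discrete))

/-! ### Feasibility and expected value of the mixed algorithm -/

section Algorithm

variable (hn : 0 < n) (hδ : 0 ≤ P.δ) (hδ1 : P.δ ≤ 1) (I : Instance n) (u : Fin n → unitInterval)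

theorem selected_zero : (P.algorithm hn hδ hδ1).selected I (0 : Fin (n + 1)) u = P.chosen I u := by
  classical
  ext e
  rw [OnlineAlgorithm.mem_selected, chosen, Finset.mem_filter]
  simp [I.history_last]

theorem selected_succ (k : Fin n) :
    (P.algorithm hn hδ hδ1).selected I (k.succ : Fin (n + 1)) u = {I.order u k} := by
  ext e
  rw [OnlineAlgorithm.mem_selected, Finset.mem_singleton, ← Equiv.symm_apply_eq]
  simp [Fin.ext_iff, eq_comm]

theorem isFeasible_algorithm (hT : 0 < P.T) (hB : 0 ≤ P.budget) (hf : 0 ≤ P.reserve) {K : ℝ}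
    (hK : 1 + P.T * (P.budget + (2 * P.radius + 1) * (P.reserve + 1)) ≤ K) :
    (P.algorithm hn hδ hδ1).IsFeasible n K := by
  intro I ω u
  have hK1 : 1 ≤ K := le_trans (le_add_of_nonneg_right (by positivity)) hK
  change Fin (n + 1) at ω
  refine Fin.cases ?_ (fun k => ?_) ω
  · rw [selected_zero]; exact (P.sum_size_chosen_le I u hT hB hf).trans hK
  · rw [selected_succ, Finset.sum_singleton]; exact (I.size_le_one _).trans hK1

include hn hδ hδ1 in
theorem integrable_chosen : Integrable fun u => ∑ e ∈ P.chosen I u, I.value e := by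
  simpa only [selected_zero] using
    (P.algorithm hn hδ hδ1).integrable_value_seed I (0 : Fin (n + 1))

/-- The positions are a permutation of the elements, so for every outcome of the times the single
picks add up to the total value. -/
theorem expectedValue_algorithm : (P.algorithm hn hδ hδ1).expectedValue I
    = (1 - P.δ) * (∫ u, ∑ e ∈ P.chosen I u, I.value e) + P.δ / n * ∑ e, I.value e := by
  have hint := (P.algorithm hn hδ hδ1).integrable_value_seed I
  have h1 : ∀ k : Fin n, Integrable fun u => I.value (I.order u k) := fun k => by
    have := hint (k.succ : Fin (n + 1))
    simpa only [selected_succ, Finset.sum_singleton] using this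
  have h2 : (P.algorithm hn hδ hδ1).expectedValue I = ∫ ω : Fin (n + 1), (∫ u,
      ∑ e ∈ (P.algorithm hn hδ hδ1).selected I ω u, I.value e) ∂(P.seedLaw hn hδ hδ1).toMeasure :=
    integral_prod _ ((P.algorithm hn hδ hδ1).integrable_value I)
  rw [h2, PMF.integral_eq_sum, Fin.sum_univ_succ]
  simp only [selected_zero, selected_succ, Finset.sum_singleton, seedLaw, PMF.ofFintype_apply,
    Fin.cons_zero, Fin.cons_succ, smul_eq_mul]
  rw [ENNReal.toReal_ofReal (by linarith), ENNReal.toReal_ofReal (by positivity), ← Finset.mul_sum,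
    ← integral_finsetSum _ fun k _ => h1 k]
  simp_rw [fun u => Equiv.sum_comp (I.order u) I.value]
  rw [integral_const, probReal_univ, one_smul]

end Algorithm

end Params

/-! ### The benchmark and two trivial algorithms -/

namespace Instance

variable (I : Instance n) {K : ℝ} {g : Fin n}

theorem exists_benchmark_eq (hK : 0 ≤ K) (g : Fin n) : ∃ S ⊆ I.green.erase g,
    ∑ e ∈ S, I.size e ≤ K ∧ I.benchmark K g = ∑ e ∈ S, I.value e := by
  set B := {x : ℝ | ∃ S : Finset (Fin n), S ⊆ I.green.erase g ∧ ∑ e ∈ S, I.size e ≤ K ∧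
    x = ∑ e ∈ S, I.value e} with hB
  have hfin : B.Finite :=
    (Set.finite_range fun S : Finset (Fin n) => ∑ e ∈ S, I.value e).subset (by
      rintro _ ⟨S, -, -, rfl⟩; exact ⟨S, rfl⟩)
  have hne : B.Nonempty := ⟨0, ∅, by simp, by simpa using hK, by simp⟩
  exact hne.csSup_mem hfin

end Instance

/-- The algorithm that takes the same decision on all elements. -/
noncomputable def constAlgorithm (c : Bool) : OnlineAlgorithm where
  Seed := Unit
  law := Measure.dirac ()
  accept _ _ _ := c
  measurable_accept _ := measurable_const

theorem selected_constAlgorithm_true (I : Instance n) (ω : (constAlgorithm true).Seed)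
    (u : Fin n → unitInterval) : (constAlgorithm true).selected I ω u = Finset.univ := by
  ext e
  rw [OnlineAlgorithm.mem_selected]
  simp [constAlgorithm]

theorem selected_constAlgorithm_false (I : Instance n) (ω : (constAlgorithm false).Seed)
    (u : Fin n → unitInterval) : (constAlgorithm false).selected I ω u = ∅ := by
  ext e
  rw [OnlineAlgorithm.mem_selected]
  simp [constAlgorithm]

theorem expectedValue_constAlgorithm_true (I : Instance n) :
    (constAlgorithm true).expectedValue I = ∑ e, I.value e := by
  simp [OnlineAlgorithm.expectedValue, selected_constAlgorithm_true]

/-! ### Choice of the comparison set and of the parameters -/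

namespace Params

variable {P : Params n} {I : Instance n}

theorem floor_le_floor_add {x y α D : ℝ} (hx : x ≤ α + D) (hy : α ≤ y) {r : ℕ} (hr : D + 1 ≤ r) : ⌊x⌋ ≤ ⌊y⌋ + r := by
  have h1 := Int.floor_le x
  have h2 := Int.lt_floor_add_one y
  have : (⌊x⌋ : ℝ) ≤ ((⌊y⌋ + r : ℤ) : ℝ) := by push_cast; linarith
  exact_mod_cast this

theorem logb_one_add_le {δ x : ℝ} (hδ : 0 < δ) (hδ1 : δ ≤ 1) (hx : 1 ≤ x) :
    Real.logb (1 + δ) x ≤ 2 * (Real.log x / δ) := by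
  have h1 : δ / 2 ≤ Real.log (1 + δ) := by
    refine le_trans ?_ (Real.one_sub_inv_le_log_of_pos (by linarith))
    rw [← one_div, one_sub_div (by linarith), div_le_div_iff₀ two_pos (by linarith)]
    nlinarith
  have h2 : 0 ≤ Real.log x := Real.log_nonneg hx
  rw [Real.logb, ← mul_div_assoc, div_le_div_iff₀ (by linarith) hδ]
  nlinarith

/-- A set of large green elements of density at least `θ` is relevant for the algorithm if the total
value of all elements is at most a polynomial factor larger than `θ`. -/
theorem relevant_of_density {R : Finset (Fin n)} {w : Fin n → ℝ} {θ : ℝ} (hδ : 0 < P.δ)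
    (hδ1 : P.δ ≤ 1) (hn : 1 ≤ n) (hθ : 0 < θ) (hsub : R ⊆ I.green)
    (hlarge : ∀ e ∈ R, 1 < n * I.size e) (hdens : ∀ e ∈ R, θ * I.size e ≤ I.value e)
    (hw0 : ∀ e, 0 ≤ w e) (hw : ∀ e ∈ R, w e ≤ I.value e)
    (hsize : (1 - P.δ) * ∑ e ∈ R, I.size e ≤ P.T * P.budget)
    (htotal : n ^ 2 * ∑ e, I.value e ≤ n ^ 6 * θ)
    (hradius : 12 * (Real.log n / P.δ) + 1 ≤ P.radius) :
    P.Relevant I R w (Finset.Icc (⌊Real.logb (1 + P.δ) (θ / n)⌋ - P.radius)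
      (⌊Real.logb (1 + P.δ) (θ / n)⌋ + 2 * P.radius)) := by
  have hn1 : (1 : ℝ) ≤ n := by exact_mod_cast hn
  have hn0 : (0 : ℝ) < n := by linarith
  have hb : 1 < 1 + P.δ := by linarith
  set α := Real.logb (1 + P.δ) (θ / n) with hα
  have hθn : 0 < θ / n := by positivity
  have hpos : ∀ e ∈ R, 0 < I.size e := fun e he => by
    by_contra h
    have := hlarge e he
    nlinarith [mul_nonpos_of_nonneg_of_nonpos hn0.le (not_lt.1 h)]
  have hvalue : ∀ e ∈ R, θ / n ≤ I.value e := fun e he => by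
    refine le_trans ?_ (hdens e he)
    rw [div_le_iff₀ hn0]
    nlinarith [hlarge e he]
  -- Densities in `R` and the values of `worth` after its first element both lie in this range. Its
  -- ends differ by a factor of at most `n ^ 6`, and a factor `n` spans at most `2 * log n / δ`
  -- levels.
  have hrange : ∀ x, θ / n ≤ x → x ≤ n * ∑ e, I.value e →
      α ≤ Real.logb (1 + P.δ) x ∧ Real.logb (1 + P.δ) x ≤ α + 12 * (Real.log n / P.δ) := by
    intro x hx hx'
    have hx0 : 0 < x := hθn.trans_le hx
    refine ⟨Real.logb_le_logb_of_le hb hθn hx, ?_⟩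
    have h1 : x ≤ θ / n * n ^ 6 := by
      refine hx'.trans ?_
      rw [div_mul_eq_mul_div, le_div_iff₀ hn0]
      linarith
    calc Real.logb (1 + P.δ) x ≤ Real.logb (1 + P.δ) (θ / n * n ^ 6) :=
          Real.logb_le_logb_of_le hb hx0 h1
      _ = α + 6 * Real.logb (1 + P.δ) n := by
          rw [Real.logb_mul hθn.ne' (by positivity), Real.logb_pow]; norm_num [hα]
      _ ≤ _ := by linarith [logb_one_add_le hδ hδ1 hn1]
  have hV : ∀ e, I.value e ≤ ∑ e, I.value e := fun e =>
    Finset.single_le_sum (fun e _ => I.value_nonneg e) (Finset.mem_univ e)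
  have hV0 : 0 ≤ ∑ e, I.value e := Finset.sum_nonneg fun e _ => I.value_nonneg e
  have hcenter : ∀ u i, (∃ e ∈ R, P.slot (u e) < i) →
      θ / n ≤ P.worth (I.profile u) i ∧ P.worth (I.profile u) i ≤ n * ∑ e, I.value e := by
    rintro u i ⟨e, he, hi⟩
    constructor
    · refine (hvalue e he).trans ?_
      have h1 : I.value e = if P.slot (I.profile u e).1 < i then (I.profile u e).2.2 else 0 := by
        rw [if_pos]; · rfl
        change P.slot (I.arrivalTime u e) < i
        rwa [Instance.arrivalTime, if_pos (hsub he)]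
      rw [h1]
      refine Finset.single_le_sum
        (f := fun e => if P.slot (I.profile u e).1 < i then (I.profile u e).2.2 else 0)
        (fun e _ => ?_) (Finset.mem_univ e)
      split_ifs
      exacts [I.value_nonneg e, le_rfl]
    · calc P.worth (I.profile u) i ≤ ∑ e, I.value e := by
            refine Finset.sum_le_sum fun e _ => ?_
            split_ifs
            exacts [le_rfl, I.value_nonneg e]
        _ ≤ n * ∑ e, I.value e := by nlinarith
  refine ⟨hsub, hlarge, fun e he => hθn.trans_le (hvalue e he), hw0, hw, hsize, ?_, ?_⟩
  · intro u i hact e he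
    obtain ⟨h1, h2⟩ := hcenter u i hact
    obtain ⟨h3, h4⟩ := hrange _ h1 h2
    have hs := hpos e he
    have h5 : θ / n ≤ I.value e / I.size e :=
      (div_le_self hθ.le hn1).trans ((le_div_iff₀ hs).2 (hdens e he))
    have h6 : I.value e / I.size e ≤ n * ∑ e, I.value e := by
      rw [div_le_iff₀ hs]
      nlinarith [hV e, hlarge e he]
    obtain ⟨h7, h8⟩ := hrange _ h5 h6
    have h9 := floor_le_floor_add h8 h3 hradius
    have h10 := floor_le_floor_add h4 h7 hradius
    rw [window, Finset.mem_Icc]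
    unfold levelOf center
    omega
  · intro u i hact
    obtain ⟨h1, h2⟩ := hcenter u i hact
    obtain ⟨h3, h4⟩ := hrange _ h1 h2
    have h6 := floor_le_floor_add h4 le_rfl hradius
    have h7 : ⌊α⌋ ≤ P.center (I.profile u) i := Int.floor_mono h3
    unfold center at h7
    refine Finset.Icc_subset_Icc ?_ ?_ <;> unfold center <;> omega

/-- The conditions on the parameters under which the algorithm is analysed. -/
structure Admissible (P : Params n) (K : ℝ) : Prop where
  pos : 0 < P.δ
  lt_one : P.δ < 1
  one_le : 1 ≤ n
  one_le_capacity : 1 ≤ K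
  le_card : K ≤ n
  inv_le : 1 / P.δ ≤ n
  slots_pos : 0 < P.T
  one_le_slots : 1 ≤ P.δ * P.T
  budget_eq : P.T * P.budget = (1 - P.δ) * (K + 1)
  reserve_eq : P.reserve = 4 * P.T / P.δ ^ 3
  le_radius : 12 * (Real.log n / P.δ) + 1 ≤ P.radius
  drops_le : 2 * ((3 * P.radius + 1) * (Real.log n / P.δ + 1)) ≤ P.δ * P.T

namespace Admissible

variable {K : ℝ} (hP : P.Admissible K)
include hP

theorem budget_nonneg : 0 ≤ P.budget := by
  have h1 : (0 : ℝ) < P.T := by exact_mod_cast hP.slots_pos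
  refine nonneg_of_mul_nonneg_right (a := (P.T : ℝ)) ?_ h1
  rw [hP.budget_eq]
  exact mul_nonneg (by linarith [hP.lt_one]) (by linarith [hP.one_le_capacity])

theorem integrable_chosen : Integrable fun u => ∑ e ∈ P.chosen I u, I.value e :=
  P.integrable_chosen hP.one_le hP.pos.le hP.lt_one.le I

/-- The expected value selected by the acceptance rule, relative to a set of large green elements of
density at least `δ V / K`. -/
theorem le_integral_value {V : ℝ} (hV : 0 < V) (htotal : ∑ e, I.value e ≤ n * V / P.δ)
    {R : Finset (Fin n)} {w : Fin n → ℝ} (hsub : R ⊆ I.green)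
    (hlarge : ∀ e ∈ R, 1 < n * I.size e)
    (hdens : ∀ e ∈ R, P.δ * V / K * I.size e ≤ I.value e)
    (hw0 : ∀ e, 0 ≤ w e) (hw : ∀ e ∈ R, w e ≤ I.value e)
    (hsize : ∑ e ∈ R, I.size e ≤ K + 1) (hne : R.Nonempty) {μ : ℝ} (hμ : ∀ e ∈ R, w e ≤ μ) :
    ∑ e ∈ tiny I, I.value e + (1 - 7 * P.δ) * ∑ e ∈ R, w e - μ
      ≤ ∫ u, ∑ e ∈ P.chosen I u, I.value e := by
  have hδ := hP.pos
  have hK := hP.one_le_capacity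
  have hT1 : (1 : ℝ) ≤ P.T := by exact_mod_cast hP.slots_pos
  have hn1 : (1 : ℝ) ≤ n := by exact_mod_cast hP.one_le
  have hδn : 1 ≤ P.δ * n := by
    have := hP.inv_le
    rw [div_le_iff₀ hδ] at this; linarith
  have hR := relevant_of_density (P := P) hδ hP.lt_one.le hP.one_le
    (by positivity : 0 < P.δ * V / K) hsub hlarge hdens hw0 hw
    (by rw [hP.budget_eq]; exact mul_le_mul_of_nonneg_left hsize (by linarith [hP.lt_one]))
    (by
      calc (n : ℝ) ^ 2 * ∑ e, I.value e ≤ n ^ 2 * (n * V / P.δ) := by gcongr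
        _ ≤ n ^ 6 * (P.δ * V / K) := by
          rw [mul_div_assoc', mul_div_assoc', div_le_div_iff₀ hδ (by linarith)]
          have h1 : K * 1 ^ 2 ≤ n * (P.δ * n) ^ 2 :=
            mul_le_mul hP.le_card (pow_le_pow_left₀ zero_le_one hδn 2) (by norm_num) (by linarith)
          calc (n : ℝ) ^ 2 * (n * V) * K = n ^ 3 * V * (K * 1 ^ 2) := by ring
            _ ≤ n ^ 3 * V * (n * (P.δ * n) ^ 2) := by gcongr
            _ = n ^ 6 * (P.δ * V) * P.δ := by ring)
    hP.le_radius
  -- The value `β = 2 * T / δ ^ 3`, half the reserve, gives equality in `2 * T ≤ δ ^ 3 * β`.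
  have hβ1 : 1 ≤ 2 * P.T / P.δ ^ 3 := by
    rw [le_div_iff₀ (by positivity)]
    nlinarith [pow_le_one₀ (n := 3) hδ.le hP.lt_one.le]
  refine hR.le_integral_value hδ hP.slots_pos hP.lt_one hP.budget_nonneg hP.one_le hβ1
    (by rw [hP.reserve_eq]; exact le_of_eq (by ring))
    (le_of_eq (by field_simp)) hP.one_le_slots ?_ hP.integrable_chosen hne hμ
  refine le_trans (le_of_eq ?_) hP.drops_le
  rw [Int.card_Icc]
  congr 3
  have : (⌊Real.logb (1 + P.δ) (P.δ * V / K / n)⌋ + 2 * (P.radius : ℤ) + 1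
    - (⌊Real.logb (1 + P.δ) (P.δ * V / K / n)⌋ - P.radius)).toNat = 3 * P.radius + 1 := by omega
  rw [this]; push_cast; ring

/-- Needed when the benchmark has no large element of sufficient density. -/
theorem sum_tiny_le_integral : ∑ e ∈ tiny I, I.value e ≤ ∫ u, ∑ e ∈ P.chosen I u, I.value e := by
  have h := integral_mono (integrable_const (∑ e ∈ tiny I, I.value e)) hP.integrable_chosen
    (fun u => by
      refine le_trans ?_ (le_value_chosen I u hP.pos hP.slots_pos)
      refine le_add_of_nonneg_right (Finset.sum_nonneg fun i _ => Finset.sum_nonneg fun ℓ _ => ?_)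
      refine mul_nonneg (density_pos hP.pos ℓ).le (le_min (load_nonneg I u ℓ i)
        (add_nonneg (P.alloc_nonneg _ _ _ _) ?_))
      rw [hP.reserve_eq]
      have := hP.pos
      positivity)
  simpa using h

/-- The acceptance rule is competitive if no element is much more valuable than the benchmark. -/
theorem benchmark_le_integral {g : Fin n} (hg : I.IsGreenMax g) (hV : 0 < I.benchmark K g)
    (htotal : ∑ e, I.value e ≤ n * I.benchmark K g / P.δ) :
    (1 - 15 * P.δ) * I.benchmark K g ≤ ∫ u, ∑ e ∈ P.chosen I u, I.value e := by
  classical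
  have hδ := hP.pos
  have hδ1 := hP.lt_one
  have hK := hP.one_le_capacity
  obtain ⟨S, hS, hSK, hVS⟩ := I.exists_benchmark_eq (by linarith : 0 ≤ K) g
  set V := I.benchmark K g with hVdef
  set θ := P.δ * V / K with hθ
  have hθ0 : 0 < θ := by positivity
  -- Elements of density below `θ` contribute at most `θ * K = δ * V`; without them the levels of
  -- `R` span a bounded range.
  set R := S.filter fun e => 1 < n * I.size e ∧ θ * I.size e ≤ I.value e with hRdef
  set S₁ := S.filter fun e => n * I.size e ≤ 1 with hS₁
  have hRS : R ⊆ S := Finset.filter_subset _ _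
  have hgS : g ∉ S := fun h => (Finset.mem_erase.1 (hS h)).1 rfl
  have hSgreen : S ⊆ I.green := hS.trans (Finset.erase_subset _ _)
  have hsplit : (1 - P.δ) * V ≤ ∑ e ∈ S₁, I.value e + ∑ e ∈ R, I.value e := by
    have h1 : ∑ e ∈ S, I.value e ≤ ∑ e ∈ S, ((if n * I.size e ≤ 1 then I.value e else 0) +
        (if 1 < n * I.size e ∧ θ * I.size e ≤ I.value e then I.value e else 0)
        + θ * I.size e) := by
      refine Finset.sum_le_sum fun e _ => ?_
      have h2 := I.value_nonneg e
      have h3 := mul_nonneg hθ0.le (I.size_nonneg e)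
      by_cases h4 : n * I.size e ≤ 1
      · rw [if_pos h4]; split_ifs <;> linarith
      · by_cases h5 : θ * I.size e ≤ I.value e
        · rw [if_neg h4, if_pos ⟨not_le.1 h4, h5⟩]; linarith
        · split_ifs <;> linarith
    rw [Finset.sum_add_distrib, Finset.sum_add_distrib, ← Finset.sum_filter, ← Finset.sum_filter,
      ← Finset.mul_sum, ← hVS] at h1
    have h2 : θ * ∑ e ∈ S, I.size e ≤ P.δ * V := by
      calc θ * ∑ e ∈ S, I.size e ≤ θ * K := by gcongr
        _ = P.δ * V := by rw [hθ]; field_simp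
    linarith
  have htiny : ∀ A : Finset (Fin n), (∀ e ∈ A, n * I.size e ≤ 1) →
      ∑ e ∈ A, I.value e ≤ ∑ e ∈ tiny I, I.value e := fun A hA =>
    Finset.sum_le_sum_of_subset_of_nonneg (fun e he => (mem_tiny I).2 (hA e he))
      fun e _ _ => I.value_nonneg e
  have hS₁t : ∀ e ∈ S₁, n * I.size e ≤ 1 := fun e he => (Finset.mem_filter.1 he).2
  have hS₁0 : 0 ≤ ∑ e ∈ S₁, I.value e := Finset.sum_nonneg fun e _ => I.value_nonneg e
  have hδV : 0 < P.δ * V := by positivity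
  rcases R.eq_empty_or_nonempty with hRe | hRne
  · rw [hRe, Finset.sum_empty, add_zero] at hsplit
    have := (htiny S₁ hS₁t).trans hP.sum_tiny_le_integral
    linarith
  obtain ⟨m, hmR, hmax⟩ := Finset.exists_max_image R I.value hRne
  have hmg : I.value m ≤ I.value g := hg.2 m (hSgreen (hRS hmR))
  have hmV : I.value m ≤ V := by
    rw [hVS]
    exact Finset.single_le_sum (fun e _ => I.value_nonneg e) (hRS hmR)
  have hRlarge : ∀ e ∈ R, 1 < n * I.size e := fun e he => (Finset.mem_filter.1 he).2.1
  have hRdens : ∀ e ∈ R, θ * I.size e ≤ I.value e := fun e he => (Finset.mem_filter.1 he).2.2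
  have hRK : ∑ e ∈ R, I.size e ≤ K :=
    (Finset.sum_le_sum_of_subset_of_nonneg hRS fun e _ _ => I.size_nonneg e).trans hSK
  have hR0 : 0 ≤ ∑ e ∈ R, I.value e := Finset.sum_nonneg fun e _ => I.value_nonneg e
  have hRV : P.δ * ∑ e ∈ R, I.value e ≤ P.δ * V := by
    refine mul_le_mul_of_nonneg_left ?_ hδ.le
    rw [hVS]
    exact Finset.sum_le_sum_of_subset_of_nonneg hRS fun e _ _ => I.value_nonneg e
  have hmain := hP.le_integral_value hV htotal (hRS.trans hSgreen) hRlarge hRdens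
    I.value_nonneg (fun e _ => le_rfl) (by linarith) hRne hmax
  -- The term `I.value m` lost in `hmain` has to be recovered, and `g` is at least as valuable as
  -- `m`. A tiny `g` is always taken by the rule.
  by_cases hgt : n * I.size g ≤ 1
  · have h1 := htiny (insert g S₁) (by
      intro e he
      rcases Finset.mem_insert.1 he with rfl | he
      exacts [hgt, hS₁t e he])
    have hgS₁ : g ∉ S₁ := fun h => hgS (Finset.filter_subset _ _ h)
    rw [Finset.sum_insert hgS₁] at h1
    linarith
  have h1 := htiny S₁ hS₁t
  by_cases hgd : θ * I.size g ≤ I.value g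
  -- A dense `g` joins `R` with its weight cut to `I.value m`: the total weight grows by this amount
  -- while the maximum stays the same. The size grows by at most one, hence `K + 1` in the budget.
  -- The loss is `δ + 7 * δ` on `V` and `7 * δ` on `I.value m ≤ V`.
  · have hgR : g ∉ R := fun h => hgS (hRS h)
    have h2 := hP.le_integral_value (w := fun e => min (I.value e) (I.value m)) hV htotal
      (R := insert g R) (Finset.insert_subset hg.1 (hRS.trans hSgreen))
      (by
        intro e he
        rcases Finset.mem_insert.1 he with rfl | he
        exacts [not_le.1 hgt, hRlarge e he])
      (by
        intro e he
        rcases Finset.mem_insert.1 he with rfl | he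
        exacts [hgd, hRdens e he])
      (fun e => le_min (I.value_nonneg e) (I.value_nonneg m)) (fun e _ => min_le_left _ _)
      (by rw [Finset.sum_insert hgR]; linarith [I.size_le_one g])
      (Finset.insert_nonempty _ _) (fun e _ => min_le_right _ _)
    rw [Finset.sum_insert hgR, min_eq_right hmg,
      Finset.sum_congr rfl fun e he => min_eq_left (hmax e he)] at h2
    have h3 : R.sum I.value = ∑ e ∈ R, I.value e := rfl
    have h4 := mul_le_mul_of_nonneg_left hmV hδ.le
    rw [h3] at h2
    linarith
  -- If `g` has low density, its value is below `θ ≤ δ * V`, so the lost term is negligible.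
  · have h2 : I.value m ≤ P.δ * V := by
      have h3 : θ * I.size g ≤ θ * 1 := mul_le_mul_of_nonneg_left (I.size_le_one g) hθ0.le
      have h4 : θ ≤ P.δ * V := div_le_self hδV.le hK
      linarith [not_le.1 hgd]
    linarith

/-- The algorithm is competitive with the benchmark. -/
theorem benchmark_le_expectedValue {g : Fin n} (hg : I.IsGreenMax g) :
    (1 - 16 * P.δ) * I.benchmark K g
      ≤ (P.algorithm hP.one_le hP.pos.le hP.lt_one.le).expectedValue I := by
  have hδ := hP.pos
  have hδ1 := hP.lt_one
  have hn0 : (0 : ℝ) < n := by exact_mod_cast hP.one_le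
  have hE0 := (P.algorithm hP.one_le hδ.le hδ1.le).expectedValue_nonneg I
  have hint : 0 ≤ ∫ u, ∑ e ∈ P.chosen I u, I.value e :=
    integral_nonneg fun u => Finset.sum_nonneg fun e _ => I.value_nonneg e
  have hsum : 0 ≤ ∑ e, I.value e := Finset.sum_nonneg fun e _ => I.value_nonneg e
  obtain ⟨S, -, -, hVS⟩ := I.exists_benchmark_eq (by linarith [hP.one_le_capacity] : 0 ≤ K) g
  have hV0 : 0 ≤ I.benchmark K g := by
    rw [hVS]; exact Finset.sum_nonneg fun e _ => I.value_nonneg e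
  rcases hV0.eq_or_lt with hV | hV
  · rw [← hV, mul_zero]; exact hE0
  rw [expectedValue_algorithm]
  have hcoef : 0 ≤ P.δ / n := by positivity
  rcases le_total (∑ e, I.value e) (n * I.benchmark K g / P.δ) with h | h
  · have h1 := hP.benchmark_le_integral hg hV h
    have h2 := mul_le_mul_of_nonneg_left h1 (by linarith : 0 ≤ 1 - P.δ)
    have h3 := mul_nonneg hcoef hsum
    nlinarith [mul_pos (mul_pos hδ hδ) hV]
  -- Here the pick at a random position alone earns the benchmark.
  · have h1 := mul_le_mul_of_nonneg_left h hcoef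
    have h2 : P.δ / n * (n * I.benchmark K g / P.δ) = I.benchmark K g := by field_simp
    have h3 := mul_nonneg (by linarith : 0 ≤ 1 - P.δ) hint
    nlinarith [mul_pos hδ hV]

end Admissible

/-- The parameters used for accuracy `δ` and capacity `K`. -/
noncomputable def standard (n : ℕ) (δ K : ℝ) : Params n :=
  let T := ⌈300 * (Real.log n / δ) ^ 3⌉₊
  { T := T
    radius := ⌈12 * (Real.log n / δ) + 1⌉₊
    δ := δ
    reserve := 4 * T / δ ^ 3
    budget := (1 - δ) * (K + 1) / T }

/-- With `Y = log n / δ`, the drops over all levels number `O(Y ^ 2)`, so `δ * T` must have this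
order; as `1 / δ ≤ 2 * Y`, `T` of order `Y ^ 3` suffices. The reserve is then `O(Y ^ 6)`, and over
`T` slots and `O(Y)` levels the reserves sum to `O(Y ^ 10)`. They must fit into the capacity of
about `δ * K` that the budget leaves free, whence the exponent `11`. -/
theorem standard_spec {δ K : ℝ} (hn : 2 ≤ n) (hδ : 0 < δ) (hδ1 : δ ≤ 1 / 32)
    (hK : 2 * 10 ^ 8 * (Real.log n / δ) ^ 11 ≤ K) (hKn : K ≤ n) :
    (standard n δ K).Admissible K ∧ 1 + (standard n δ K).T * ((standard n δ K).budget +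
      (2 * (standard n δ K).radius + 1) * ((standard n δ K).reserve + 1)) ≤ K := by
  set Y := Real.log n / δ with hY
  set T : ℕ := ⌈300 * Y ^ 3⌉₊ with hT
  set r : ℕ := ⌈12 * Y + 1⌉₊ with hr
  have hlog : 0.69 ≤ Real.log n := by
    have h1 : Real.log 2 ≤ Real.log n :=
      Real.log_le_log two_pos (by exact_mod_cast hn)
    linarith [Real.log_two_gt_d9]
  have hYδ : Y * δ = Real.log n := div_mul_cancel₀ _ hδ.ne'
  have hY22 : 22 ≤ Y := by
    rw [hY, le_div_iff₀ hδ]; linarith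
  have hinv : 1 / δ ≤ 2 * Y := by
    rw [div_le_iff₀ hδ]; linarith
  have hT1 : 300 * Y ^ 3 ≤ T := Nat.le_ceil _
  have hY3 : 1 ≤ Y ^ 3 := one_le_pow₀ (by linarith)
  have hT2 : (T : ℝ) ≤ 301 * Y ^ 3 := by
    have := (Nat.ceil_lt_add_one (by positivity : 0 ≤ 300 * Y ^ 3)).le
    linarith
  have hr1 : 12 * Y + 1 ≤ r := Nat.le_ceil _
  have hr2 : (r : ℝ) ≤ 12 * Y + 2 := by
    have := (Nat.ceil_lt_add_one (by linarith : 0 ≤ 12 * Y + 1)).le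
    linarith
  have hT0 : (0 : ℝ) < T := by linarith
  have hδT : 200 * Y ^ 2 ≤ δ * T := by
    have h1 : δ * (300 * Y ^ 3) ≤ δ * T := mul_le_mul_of_nonneg_left hT1 hδ.le
    have h2 : δ * (300 * Y ^ 3) = 300 * (Y * δ) * Y ^ 2 := by ring
    rw [h2, hYδ] at h1
    nlinarith [sq_nonneg Y]
  have hY11 : Y ≤ Y ^ 11 := le_self_pow₀ (by linarith) (by norm_num)
  have hK1 : 2 * Y ≤ K := by linarith
  refine ⟨⟨hδ, by change δ < 1; linarith, by omega, by linarith, hKn, ?_, ?_, ?_, ?_, rfl, hr1, ?_⟩,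
    ?_⟩
  · exact hinv.trans (hK1.trans hKn)
  · exact_mod_cast hT0
  · change 1 ≤ δ * T
    nlinarith
  · change (T : ℝ) * ((1 - δ) * (K + 1) / T) = _
    rw [mul_div_cancel₀ _ hT0.ne']; rfl
  · change 2 * ((3 * (r : ℝ) + 1) * (Y + 1)) ≤ δ * T
    nlinarith
  · change 1 + (T : ℝ) * ((1 - δ) * (K + 1) / T + (2 * r + 1) * (4 * T / δ ^ 3 + 1)) ≤ K
    have h1 : (T : ℝ) * ((1 - δ) * (K + 1) / T + (2 * r + 1) * (4 * T / δ ^ 3 + 1))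
        = (1 - δ) * (K + 1) + T * ((2 * r + 1) * (4 * T / δ ^ 3 + 1)) := by
      rw [mul_add, mul_div_cancel₀ _ hT0.ne']
    have h2 : 4 * T / δ ^ 3 + 1 ≤ 12040 * Y ^ 6 := by
      have h3 : 1 / δ ^ 3 ≤ 8 * Y ^ 3 := by
        calc 1 / δ ^ 3 = (1 / δ) ^ 3 := by rw [div_pow, one_pow]
          _ ≤ (2 * Y) ^ 3 := pow_le_pow_left₀ (by positivity) hinv 3
          _ = _ := by ring
      have h4 : 4 * T / δ ^ 3 ≤ 4 * (301 * Y ^ 3) * (8 * Y ^ 3) := by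
        rw [div_eq_mul_one_div]
        exact mul_le_mul (by linarith) h3 (by positivity) (by positivity)
      have h5 : 4 * (301 * Y ^ 3) * (8 * Y ^ 3) = 9632 * Y ^ 6 := by ring
      have h6 : 1 ≤ Y ^ 6 := one_le_pow₀ (by linarith)
      linarith
    have h3 : 2 * (r : ℝ) + 1 ≤ 25 * Y := by linarith
    have h4 : T * ((2 * r + 1) * (4 * T / δ ^ 3 + 1))
        ≤ 301 * Y ^ 3 * (25 * Y * (12040 * Y ^ 6)) := by
      gcongr
    have h5 : 301 * Y ^ 3 * (25 * Y * (12040 * Y ^ 6)) = 90601000 * Y ^ 10 := by ring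
    have h6 : 10 ^ 8 * Y ^ 10 ≤ δ * K := by
      have h7 := mul_le_mul_of_nonneg_left hK hδ.le
      have h8 : δ * (2 * 10 ^ 8 * Y ^ 11) = 2 * 10 ^ 8 * (Y * δ) * Y ^ 10 := by ring
      rw [h8, hYδ] at h7
      have h9 : 0 ≤ Y ^ 10 := by positivity
      nlinarith
    have h7 : 1 ≤ Y ^ 10 := one_le_pow₀ (by linarith)
    rw [h1]
    linarith

end Params

end ByzantineKnapsack

theorem theorem2 :
    ∃ (C : ℝ) (a : ℕ), 0 < C ∧
      ∀ (ε : ℝ) (n : ℕ) (K : ℝ), 0 < ε → ε < 1 → C * (ε⁻¹ * Real.log n) ^ a ≤ K →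
        ∃ A : ByzantineKnapsack.OnlineAlgorithm, A.IsFeasible n K ∧
          ∀ (I : ByzantineKnapsack.Instance n) (g : Fin n), I.IsGreenMax g →
            I.benchmark K g ≤ (1 + ε) * A.expectedValue I := by
  -- The accuracy is `δ = ε / 32`, so the guarantee `1 - 16 * δ` is `1 - ε / 2`, and `(1 + ε) * (1 -
  -- ε / 2) ≥ 1` for `ε ≤ 1`.
  refine ⟨2 * 10 ^ 8 * 32 ^ 11, 11, by positivity, fun ε n K hε hε1 hK => ?_⟩
  have hlog : 0 ≤ Real.log n := Real.log_natCast_nonneg n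
  have hK0 : 0 ≤ K := le_trans (by positivity) hK
  rcases le_or_gt (n : ℝ) K with hnK | hnK
  · refine ⟨ByzantineKnapsack.constAlgorithm true, fun I ω u => ?_, fun I g _ => ?_⟩
    · rw [ByzantineKnapsack.selected_constAlgorithm_true]
      calc ∑ e, I.size e ≤ ∑ _e : Fin n, (1 : ℝ) := Finset.sum_le_sum fun e _ => I.size_le_one e
        _ = n := by simp
        _ ≤ K := hnK
    · rw [ByzantineKnapsack.expectedValue_constAlgorithm_true]
      obtain ⟨S, -, -, hS⟩ := I.exists_benchmark_eq hK0 g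
      have h1 : ∑ e ∈ S, I.value e ≤ ∑ e, I.value e :=
        Finset.sum_le_sum_of_subset_of_nonneg (Finset.subset_univ _) fun e _ _ => I.value_nonneg e
      have h2 : 0 ≤ ∑ e, I.value e := Finset.sum_nonneg fun e _ => I.value_nonneg e
      rw [hS]
      nlinarith
  -- With at most one element, only the one left out can be green and the benchmark is zero. From
  -- here on `log n` is bounded away from `0`.
  rcases Nat.lt_or_ge n 2 with hn | hn
  · refine ⟨ByzantineKnapsack.constAlgorithm false, fun I ω u => ?_, fun I g _ => ?_⟩
    · rw [ByzantineKnapsack.selected_constAlgorithm_false, Finset.sum_empty]; exact hK0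
    · obtain ⟨S, hSg, -, hS⟩ := I.exists_benchmark_eq hK0 g
      have hempty : S = ∅ := Finset.eq_empty_of_forall_notMem fun e he =>
        (Finset.mem_erase.1 (hSg he)).1 (Fin.ext (by omega))
      rw [hS, hempty, Finset.sum_empty]
      exact mul_nonneg (by linarith) (ByzantineKnapsack.OnlineAlgorithm.expectedValue_nonneg _ I)
  obtain ⟨hP, hcap⟩ := ByzantineKnapsack.Params.standard_spec (δ := ε / 32) (K := K) hn
    (by positivity) (by linarith) (by
      refine le_trans (le_of_eq ?_) hK
      have : Real.log n / (ε / 32) = 32 * (ε⁻¹ * Real.log n) := by field_simp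
      rw [this, mul_pow]; ring) hnK.le
  refine ⟨_, ByzantineKnapsack.Params.isFeasible_algorithm _ hP.one_le hP.pos.le hP.lt_one.le
    hP.slots_pos hP.budget_nonneg ?_ hcap, fun I g hg => ?_⟩
  · rw [hP.reserve_eq]
    have := hP.pos
    positivity
  · have h1 := hP.benchmark_le_expectedValue hg
    obtain ⟨S, -, -, hS⟩ := I.exists_benchmark_eq hK0 g
    have hV0 : 0 ≤ I.benchmark K g := by
      rw [hS]; exact Finset.sum_nonneg fun e _ => I.value_nonneg e
    change (1 - 16 * (ε / 32)) * _ ≤ _ at h1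
    have h3 := mul_le_mul_of_nonneg_left h1 (by linarith : 0 ≤ 1 + ε)
    have h4 : 0 ≤ ε * (1 - ε) * I.benchmark K g :=
      mul_nonneg (mul_nonneg hε.le (by linarith)) hV0
    refine le_trans ?_ h3
    nlinarith
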